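/- **Steepest-descent curve.** Let $C\subset\mathbb C$ consist of $0$ and of all $\theta$ with $\operatorname{Re}\theta\in(-\pi,\pi)\setminus\{0\}$ and $\operatorname{Im}(e^{i\theta}-i\theta)=0$. Let $\mathcal R=\{z:\operatorname{Re}z>-1,\ -\pi<\operatorname{Im}z<0\}$ and $\Omega=\{\theta:0<\operatorname{Re}\theta<\pi,\ \operatorname{Im}\theta<0\}$, let $\gamma$ be the positively oriented boundary of $\mathcal R$, and put $$W(z)=\frac{z}{2\pi i}\int_\gamma\frac{\xi+1}{\xi e^{\xi}-z}\,d\xi,\qquad \theta_+(\tau)=i\bigl(1-\tau^2+W(-e^{\tau^2-1})\bigr)\quad(\tau>0),$$ $\theta(\tau)=\theta_+(\tau)$ for $\tau>0$, $\theta(0)=0$, $\theta(\tau)=-\overline{\theta_+(-\tau)}$ for $\tau<0$. Then for $\tau>0$ the number $W(-e^{\tau^2-1})$ is the unique $w\in\mathcal R$ with $we^w=-e^{\tau^2-1}$, and $\theta(\tau)$ is the unique $\theta\in\Omega$ with $e^{i\theta}-i\theta=1-\tau^2$. The map $\theta:\mathbb R\to\mathbb C$ is $C^\infty$, $\theta'(\tau)\ne0$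 for all $\tau$, $\theta$ is a bijection of $\mathbb R$ onto $C$, and $e^{i\theta(\tau)}-i\theta(\tau)=1-\tau^2$ for all $\tau\in\mathbb R$. **Representation.** Let $g$ be entire with $g(0)\neq0$, let $p_n(x)=n!\,[z^n]\,e^{xz}/g(z)$ be its Appell polynomials and $\pi_n(x)=p_n(nx)$. Let $x\in\mathbb C\setminus\{0\}$, $n\in\{0,1,2,\dots\}$ and $F(\theta)=e^{n(e^{i\theta}-i\theta)}/g(e^{i\theta}/x)$. To each zero $\zeta_k$ of $g$ (the zeros being listed without multiplicity) associate the zero $\theta_k=\operatorname{Arg}(x\zeta_k)-i\log|x\zeta_k|$ of $g(e^{i\theta}/x)$, where $\operatorname{Arg}\in(-\pi,\pi]$. For $\operatorname{Re}\theta\in(-\pi,\pi)$ put $\psi(\theta)=\operatorname{Im}\theta-\log\frac{\sin\operatorname{Re}\theta}{\operatorname{Re}\theta}$ if $\operatorname{Re}\theta\ne0$ and $\psi(\theta)=\operatorname{Im}\theta$ if $\operatorname{Re}\theta=0$; put $\Theta(t)=1,\tfrac12,0$ for $t>0$, $t=0$, $t<0$, and read $\Theta(\psi(\theta))=1$ if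 $\operatorname{Re}\theta=\pi$. Assume: 1. every zero $\zeta_k$ of $g$ with $\theta_k\in C$ is simple; 2. $S\subset(0,\infty)$ is an unbounded set such that for $T\in S$ the two closed horizontal segments $c_1(T)$, from $-\pi+i\operatorname{Im}\theta(T)$ to $\theta(-T)$, and $c_2(T)$, from $\theta(T)$ to $\pi+i\operatorname{Im}\theta(T)$, contain no zero of $g(e^{i\theta}/x)$, and $\int_{c_1(T)}F\,d\theta+\int_{c_2(T)}F\,d\theta\to0$ as $T\to\infty$, $T\in S$; 3. the sum of the residues converges, in the sense that the finite sums over the $\theta_k$ with $\operatorname{Im}\theta_k>\operatorname{Im}\theta(T)$ converge as $T\to\infty$, $T\in S$: $$\sum_k\Theta(\psi(\theta_k))\operatorname{Res}(F;\theta_k):=\lim_{\substack{T\to\infty\\T\in S}}\ \sum_{k:\ \operatorname{Im}\theta_k>\operatorname{Im}\theta(T)}\Theta(\psi(\theta_k))\operatorname{Res}(F;\theta_k).$$ Then the principal value $$\mathrm{PV}\!\int_{-\infty}^{\infty}\frac{\theta'(\tau)e^{-n\tau^2}}{g(e^{i\theta(\tau)}/x)}\,d\tau:=\lim_{\substack{T\to\infty\\T\in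 S}}\ \lim_{\varepsilon\downarrow0}\int_{\{|\tau|\le T,\ |\tau-p|\ge\varepsilon\ \forall p\in P\}}\frac{\theta'(\tau)e^{-n\tau^2}}{g(e^{i\theta(\tau)}/x)}\,d\tau,\qquad P=\{\tau\in\mathbb R: g(e^{i\theta(\tau)}/x)=0\},$$ exists, and $$\frac{\pi_n(x)}{n!}=\frac{x^n}{2\pi}\left(e^n\,\mathrm{PV}\!\int_{-\infty}^{\infty}\frac{\theta'(\tau)e^{-n\tau^2}}{g(e^{i\theta(\tau)}/x)}\,d\tau-2\pi i\sum_k\Theta(\psi(\theta_k))\operatorname{Res}(F;\theta_k)\right).$$ -/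

import Mathlib

open Complex Set Filter Topology MeasureTheory
open scoped ContDiff

namespace Appell

noncomputable section

/-- The Appell polynomials of `g`: `p_n(x) = n! [z^n] (e^{xz} / g z)`, i.e. the `n`-th derivative
of `z ↦ e^{xz} / g z` at `0`. -/
def appell (g : ℂ → ℂ) (n : ℕ) (x : ℂ) : ℂ :=
  iteratedDeriv n (fun z : ℂ => cexp (x * z) / g z) 0

/-- The rescaled Appell polynomials `π_n(x) = p_n(n x)`. -/
def rescaledAppell (g : ℂ → ℂ) (n : ℕ) (x : ℂ) : ℂ := appell g n (n * x)

/-- The residue of `f` at `a`: the limit (eventually constant if `f` is meromorphic at `a`) of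
`(2πi)⁻¹ ∮ f` over small positively oriented circles about `a`. -/
def residue (f : ℂ → ℂ) (a : ℂ) : ℂ :=
  limUnder (𝓝[>] (0 : ℝ)) fun r => (2 * Real.pi * I)⁻¹ * ∮ z in C(a, r), f z

/-! ### The steepest-descent curve and its parametrization -/

/-- The steepest-descent curve through the saddle point `0`: the part of
`Im (e^{iθ} - iθ) = 0` in the strip `-π < Re θ < π`, without the points `≠ 0` of the imaginary
axis (which form the steepest-ascent curve). -/
def curveC : Set ℂ :=
  {θ | θ = 0 ∨
    (θ.re ∈ Ioo (-Real.pi) Real.pi ∧ θ.re ≠ 0 ∧ (cexp (I * θ) - I * θ).im = 0)}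

/-- The half-strip `0 < Re θ < π`, `Im θ < 0`. -/
def regionOmega : Set ℂ := {θ | θ.re ∈ Ioo 0 Real.pi ∧ θ.im < 0}

/-- The half-strip `Re z > -1`, `-π < Im z < 0`. -/
def regionR : Set ℂ := {z | -1 < z.re ∧ z.im ∈ Ioo (-Real.pi) 0}

/-- The integrand `(ξ + 1) / (ξ e^ξ - z)`. -/
def lambertKernel (z ξ : ℂ) : ℂ := (ξ + 1) / (ξ * cexp ξ - z)

/-- The branch `W(z) = z / (2πi) ∫_γ (ξ + 1) / (ξ e^ξ - z) dξ` of the Lambert function, where `γ`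
is the positively oriented boundary of `regionR`: the ray `[-1, +∞)` traversed leftwards, the
segment from `-1` down to `-1 - πi`, and the ray `[-1, +∞) - πi` traversed rightwards. -/
def lambertW (z : ℂ) : ℂ :=
  z / (2 * Real.pi * I) *
    (-(∫ t in Ioi (-1 : ℝ), lambertKernel z (t : ℂ))
      + I * (∫ y in (0 : ℝ)..(-Real.pi), lambertKernel z (-1 + y * I))
      + ∫ t in Ioi (-1 : ℝ), lambertKernel z (t - Real.pi * I))

/-- `θ₊(τ) = i (1 - τ² + W(-e^{τ² - 1}))`. -/
def thetaPlus (τ : ℝ) : ℂ :=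
  I * (1 - (τ : ℂ) ^ 2 + lambertW (-cexp ((τ : ℂ) ^ 2 - 1)))

/-- The parametrization `θ(τ)` of the steepest-descent curve. -/
def theta (τ : ℝ) : ℂ :=
  if 0 < τ then thetaPlus τ
  else if τ = 0 then 0
  else -(starRingEnd ℂ) (thetaPlus (-τ))

/-! ### The residue term -/

/-- The integrand `e^{n(e^{iθ} - iθ)} / g(e^{iθ}/x)`. -/
def integrand (g : ℂ → ℂ) (x : ℂ) (n : ℕ) (θ : ℂ) : ℂ :=
  cexp (n * (cexp (I * θ) - I * θ)) / g (cexp (I * θ) / x)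

/-- The zero `θ = Arg(xζ) - i log |xζ|` of `g(e^{iθ}/x)` in the strip `-π < Re θ ≤ π` that
corresponds to a zero `ζ` of `g`. -/
def thetaZero (x ζ : ℂ) : ℂ := (arg (x * ζ) : ℂ) - I * (Real.log ‖x * ζ‖ : ℂ)

/-- The step function with value `1/2` at `0`. -/
def stepTheta (t : ℝ) : ℝ := if 0 < t then 1 else if t = 0 then 1 / 2 else 0

/-- `ψ`, on the strip `-π < Re θ < π`; it is positive above the curve and zero on it. -/
def psi (θ : ℂ) : ℝ :=
  if θ.re = 0 then θ.im else θ.im - Real.log (Real.sin θ.re / θ.re)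

/-- The weight `Θ(ψ(θ))`. On the line `Re θ = π`, where `sin (Re θ) / Re θ = 0` and `ψ` is to be
read as `+∞`, every point is above the curve and the weight is `1`. -/
def weight (θ : ℂ) : ℝ := if θ.re = Real.pi then 1 else stepTheta (psi θ)

/-- The (finite) sum of the weighted residues at those `θ_k` whose imaginary part exceeds that of
the point `θ(T)` of the curve. -/
def residueSum (g : ℂ → ℂ) (x : ℂ) (n : ℕ) (T : ℝ) : ℂ :=
  ∑ᶠ ζ ∈ {ζ : ℂ | g ζ = 0 ∧ (theta T).im < (thetaZero x ζ).im},
    (weight (thetaZero x ζ) : ℂ) * residue (integrand g x n) (thetaZero x ζ)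

/-! ### The horizontal segments closing the contour -/

/-- No zero of `g(e^{iθ}/x)` lies on the two closed horizontal segments at height `Im θ(T)` that
join the lines `Re θ = ∓π` to the points `θ(-T)` and `θ(T)` of the curve. -/
def SegmentsFree (g : ℂ → ℂ) (x : ℂ) (T : ℝ) : Prop :=
  ∀ X ∈ Icc (-Real.pi) (theta (-T)).re ∪ Icc (theta T).re Real.pi,
    g (cexp (I * (X + (theta T).im * I)) / x) ≠ 0

/-- The contribution of these two segments to the contour integral. -/
def segmentContribution (g : ℂ → ℂ) (x : ℂ) (n : ℕ) (T : ℝ) : ℂ :=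
  (∫ X in (-Real.pi)..(theta (-T)).re, integrand g x n (X + (theta T).im * I))
    + ∫ X in (theta T).re..Real.pi, integrand g x n (X + (theta T).im * I)

/-! ### The principal-value integral -/

/-- `PV ∫_{-T}^{T} f = v`, with symmetric excisions at the points of `P`. -/
def HasPVIntegralUpTo (f : ℝ → ℂ) (P : Set ℝ) (T : ℝ) (v : ℂ) : Prop :=
  Tendsto (fun ε : ℝ => ∫ τ in {τ | τ ∈ Icc (-T) T ∧ ∀ p ∈ P, ε ≤ |τ - p|}, f τ)
    (𝓝[>] 0) (𝓝 v)

/-- `PV ∫_{-∞}^{∞} f = v`, with symmetric excisions at the points of `P`, as the limit of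
`PV ∫_{-T}^{T} f` for `T → ∞` in `S`. -/
def HasPVIntegral (f : ℝ → ℂ) (P : Set ℝ) (S : Set ℝ) (v : ℂ) : Prop :=
  ∃ J : ℝ → ℂ, (∀ T ∈ S, HasPVIntegralUpTo f P T (J T)) ∧ Tendsto J (atTop ⊓ 𝓟 S) (𝓝 v)

end

end Appell

/-
Under `w = e^{iθ}` the integral of `e^{n(e^{iθ} - iθ)} / g(e^{iθ}/x)` becomes the integral of
`e^{nw} / (w^{n+1} g(w/x)) dw`, and the residue of the latter at `0` is `π_n(x) / (n! xⁿ)`. The part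
`|τ| ≤ T` of the steepest-descent curve becomes an arc which the circle through its end points
closes up; in polar coordinates the closed path is a graph `‖w‖ = ϱ(arg w)`. In a disc containing
the path the integrand is a sum of simple fractions `c / (w - a)` and of a derivative. The
principal value of `∮ dw / (w - a)` is read off a branch of the logarithm, `log (1 - w/a)` for `a`
outside or on the path and `log (1 - a/w)` for `a` inside, and equals `2πi` times the weight
`Θ(ψ)` of the corresponding zero. The limit `T → ∞` finishes the proof.
-/

namespace Appell

open Real (sinc)
open scoped Real

/-! ### The curve as a graph over the real part -/

lemma sinc_abs (a : ℝ) : sinc |a| = sinc a := by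
  rcases abs_choice a with h | h <;> simp only [h, Real.sinc_neg]

lemma sinc_pos {a : ℝ} (ha : a ∈ Ioo (-π) π) : 0 < sinc a := by
  rcases eq_or_ne a 0 with rfl | h0
  · simp
  · rw [← sinc_abs, Real.sinc_of_ne_zero (abs_ne_zero.2 h0)]
    have := abs_pos.2 h0
    exact div_pos (Real.sin_pos_of_pos_of_lt_pi this (abs_lt.2 ha)) this

lemma mul_sinc (a : ℝ) : a * sinc a = Real.sin a := by
  rcases eq_or_ne a 0 with rfl | h
  · simp
  · rw [Real.sinc_of_ne_zero h, mul_div_cancel₀ _ h]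

lemma mul_cos_lt_sin {a : ℝ} (ha : a ∈ Ioo 0 π) : a * Real.cos a < Real.sin a := by
  have hmono : StrictMonoOn (fun t : ℝ => Real.sin t - t * Real.cos t) (Icc 0 π) := by
    refine strictMonoOn_of_deriv_pos (convex_Icc _ _) (by fun_prop) fun t ht => ?_
    rw [interior_Icc] at ht
    have hderiv : HasDerivAt (fun t : ℝ => Real.sin t - t * Real.cos t) (t * Real.sin t) t :=
      ((Real.hasDerivAt_sin t).sub ((hasDerivAt_id t).mul (Real.hasDerivAt_cos t))).congr_deriv
        (by simp)
    rw [hderiv.deriv]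
    exact mul_pos ht.1 (Real.sin_pos_of_pos_of_lt_pi ht.1 ht.2)
  simpa using hmono (left_mem_Icc.2 Real.pi_pos.le) ⟨ha.1.le, ha.2.le⟩ ha.1

lemma hasDerivAt_sinc {a : ℝ} (h : a ≠ 0) :
    HasDerivAt sinc ((a * Real.cos a - Real.sin a) / a ^ 2) a := by
  refine (((Real.hasDerivAt_sin a).div (hasDerivAt_id a) h).congr_of_eventuallyEq ?_).congr_deriv
    (by simp only [id]; ring)
  filter_upwards [isOpen_ne.mem_nhds h] with t ht using Real.sinc_of_ne_zero ht

lemma strictAntiOn_sinc : StrictAntiOn sinc (Ico 0 π) := by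
  refine strictAntiOn_of_deriv_neg (convex_Ico _ _) Real.continuous_sinc.continuousOn fun t ht => ?_
  rw [interior_Ico] at ht
  rw [(hasDerivAt_sinc ht.1.ne').deriv]
  exact div_neg_of_neg_of_pos (by linarith [mul_cos_lt_sin ht]) (pow_pos ht.1 2)

/-- The imaginary part of the point of the curve with real part `a`; at `a = 0` this is `0`. -/
noncomputable def height (a : ℝ) : ℝ := Real.log (sinc a)

/-- The value of `e^{iθ} - iθ` at the point `θ` of the curve with real part `a`. -/
noncomputable def level (a : ℝ) : ℝ := Real.cos a / sinc a + height a

/-- The point of the curve with real part `a`. -/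
noncomputable def graphPt (a : ℝ) : ℂ := a + height a * I

@[simp] lemma graphPt_re (a : ℝ) : (graphPt a).re = a := by simp [graphPt]

@[simp] lemma graphPt_im (a : ℝ) : (graphPt a).im = height a := by simp [graphPt]

lemma height_abs (a : ℝ) : height |a| = height a := by rw [height, height, sinc_abs]

lemma height_neg (a : ℝ) : height (-a) = height a := by simp [height]

lemma level_zero : level 0 = 1 := by simp [level, height]

lemma level_abs (a : ℝ) : level |a| = level a := by
  rw [level, level, sinc_abs, height_abs, Real.cos_abs]

lemma exp_neg_height {a : ℝ} (ha : a ∈ Ioo (-π) π) : Real.exp (-height a) = (sinc a)⁻¹ := by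
  rw [height, Real.exp_neg, Real.exp_log (sinc_pos ha)]

lemma continuousOn_level : ContinuousOn level (Ioo (-π) π) :=
  (Real.continuous_cos.continuousOn.div Real.continuous_sinc.continuousOn
    fun _ ha => (sinc_pos ha).ne').add
    (Real.continuous_sinc.continuousOn.log fun _ ha => (sinc_pos ha).ne')

lemma Ico_subset_strip : Ico 0 π ⊆ Ioo (-π) π := fun _ ha =>
  ⟨(neg_neg_of_pos Real.pi_pos).trans_le ha.1, ha.2⟩

lemma abs_mem_Ico {a : ℝ} (ha : a ∈ Ioo (-π) π) : |a| ∈ Ico 0 π := ⟨abs_nonneg a, abs_lt.2 ha⟩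

lemma hasDerivAt_level {a : ℝ} (ha : a ∈ Ioo 0 π) :
    HasDerivAt level (-((Real.sin a - a * Real.cos a) ^ 2 + (a * Real.sin a) ^ 2) /
      (a * Real.sin a ^ 2)) a := by
  have hsin := Real.sin_pos_of_pos_of_lt_pi ha.1 ha.2
  have hpos : sinc a ≠ 0 := (sinc_pos (Ico_subset_strip ⟨ha.1.le, ha.2⟩)).ne'
  have hd := hasDerivAt_sinc ha.1.ne'
  refine (((Real.hasDerivAt_cos a).div hd hpos).add (hd.log hpos)).congr_deriv ?_
  rw [Real.sinc_of_ne_zero ha.1.ne']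
  have := ha.1.ne'
  field_simp
  ring

lemma strictAntiOn_level : StrictAntiOn level (Ico 0 π) := by
  refine strictAntiOn_of_deriv_neg (convex_Ico _ _) (continuousOn_level.mono Ico_subset_strip)
    fun t ht => ?_
  rw [interior_Ico] at ht
  have hsin := Real.sin_pos_of_pos_of_lt_pi ht.1 ht.2
  have ht0 := ht.1
  rw [(hasDerivAt_level ht).deriv]
  exact div_neg_of_neg_of_pos (neg_neg_of_pos (by positivity)) (by positivity)

lemma level_lt_level_iff {a b : ℝ} (ha : a ∈ Ioo (-π) π) (hb : b ∈ Ioo (-π) π) :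
    level b < level a ↔ |a| < |b| := by
  rw [← level_abs a, ← level_abs b,
    strictAntiOn_level.lt_iff_gt (abs_mem_Ico hb) (abs_mem_Ico ha)]

lemma height_lt_height {a b : ℝ} (hb : b ∈ Ioo (-π) π) (h : |a| < |b|) : height b < height a := by
  have hb' := abs_mem_Ico hb
  rw [← height_abs a, ← height_abs b]
  exact Real.log_lt_log (sinc_pos (Ico_subset_strip hb'))
    (strictAntiOn_sinc ⟨abs_nonneg a, h.trans hb'.2⟩ hb' h)

lemma height_le_height {a b : ℝ} (hb : b ∈ Ioo (-π) π) (h : |a| ≤ |b|) : height b ≤ height a := by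
  rcases h.eq_or_lt with h | h
  · rw [← height_abs a, h, height_abs]
  · exact (height_lt_height hb h).le

lemma height_neg_of_ne_zero {a : ℝ} (ha : a ∈ Ioo (-π) π) (h0 : a ≠ 0) : height a < 0 := by
  simpa [height] using height_lt_height (a := 0) ha (by simpa using h0)

lemma exists_level_le (c : ℝ) : ∃ b ∈ Ico 0 π, level b ≤ c := by
  have hsmall : ∀ᶠ b in 𝓝[<] π, sinc b < Real.exp c := by
    refine (Real.continuous_sinc.continuousAt.mono_left nhdsWithin_le_nhds).eventually_lt_const ?_
    rw [Real.sinc_of_ne_zero Real.pi_ne_zero, Real.sin_pi, zero_div]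
    exact Real.exp_pos c
  obtain ⟨b, hbc, hb⟩ := (hsmall.and (Ioo_mem_nhdsLT (half_lt_self Real.pi_pos))).exists
  have hb' : b ∈ Ico 0 π := ⟨by linarith [hb.1, Real.pi_pos], hb.2⟩
  have hpos := sinc_pos (Ico_subset_strip hb')
  refine ⟨b, hb', add_le_of_nonpos_of_le (div_nonpos_of_nonpos_of_nonneg ?_ hpos.le)
    ((Real.log_lt_iff_lt_exp hpos).2 hbc).le⟩
  exact Real.cos_nonpos_of_pi_div_two_le_of_le hb.1.le (by linarith [hb.2, Real.pi_pos])

lemma exists_level_eq {c : ℝ} (hc : c ≤ 1) : ∃ a ∈ Ico 0 π, level a = c := by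
  obtain ⟨b, hb, hbc⟩ := exists_level_le c
  obtain ⟨a, ha, hac⟩ := intermediate_value_Icc' hb.1
    (continuousOn_level.mono ((Icc_subset_Ico_right hb.2).trans Ico_subset_strip))
    (show c ∈ Icc (level b) (level 0) from ⟨hbc, by rwa [level_zero]⟩)
  exact ⟨a, ⟨ha.1, ha.2.trans_lt hb.2⟩, hac⟩

lemma exp_I_mul_sub_re (θ : ℂ) :
    (cexp (I * θ) - I * θ).re = Real.exp (-θ.im) * Real.cos θ.re + θ.im := by
  simp [exp_re]

lemma exp_I_mul_sub_im (θ : ℂ) :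
    (cexp (I * θ) - I * θ).im = Real.exp (-θ.im) * Real.sin θ.re - θ.re := by
  simp [exp_im]

lemma exp_I_mul_sub_graphPt {a : ℝ} (ha : a ∈ Ioo (-π) π) :
    cexp (I * graphPt a) - I * graphPt a = level a := by
  have hpos := (sinc_pos ha).ne'
  apply Complex.ext
  · rw [exp_I_mul_sub_re, ofReal_re, graphPt_re, graphPt_im, exp_neg_height ha, level]
    ring
  · rw [exp_I_mul_sub_im, ofReal_im, graphPt_re, graphPt_im, exp_neg_height ha, ← mul_sinc a]
    field_simp
    ring

lemma eq_graphPt_of_im_eq_zero {θ : ℂ} (h0 : θ.re ≠ 0)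
    (him : (cexp (I * θ) - I * θ).im = 0) : θ = graphPt θ.re := by
  rw [exp_I_mul_sub_im, ← mul_sinc, sub_eq_zero] at him
  have hexp : sinc θ.re = Real.exp θ.im := by
    rw [← inv_inj, ← Real.exp_neg, eq_comm]
    exact eq_inv_of_mul_eq_one_left (mul_left_cancel₀ h0 (by linear_combination him))
  apply Complex.ext <;> simp [height, hexp]

/-! ### The half-strips -/

/-- The real part of the solution of `e^{iθ} - iθ = 1 - τ²` with `0 ≤ Re θ < π`. -/
noncomputable def angle (τ : ℝ) : ℝ :=
  (exists_level_eq (sub_le_self 1 (sq_nonneg τ))).choose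

lemma angle_mem (τ : ℝ) : angle τ ∈ Ico 0 π :=
  (exists_level_eq (sub_le_self 1 (sq_nonneg τ))).choose_spec.1

lemma level_angle (τ : ℝ) : level (angle τ) = 1 - τ ^ 2 :=
  (exists_level_eq (sub_le_self 1 (sq_nonneg τ))).choose_spec.2

lemma angle_pos {τ : ℝ} (h : τ ≠ 0) : 0 < angle τ := by
  refine (angle_mem τ).1.lt_of_ne fun h0 => ?_
  have := level_angle τ
  rw [← h0, level_zero] at this
  exact h (pow_eq_zero_iff two_ne_zero |>.1 (by linarith))

lemma exp_I_mul_sub_graphPt_angle (τ : ℝ) :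
    cexp (I * graphPt (angle τ)) - I * graphPt (angle τ) = 1 - (τ : ℂ) ^ 2 := by
  rw [exp_I_mul_sub_graphPt (Ico_subset_strip (angle_mem τ)), level_angle]
  push_cast
  ring

lemma eq_graphPt_and_level_eq {τ : ℝ} {θ : ℂ} (h : θ.re ∈ Ioo (-π) π) (h0 : θ.re ≠ 0)
    (hθ : cexp (I * θ) - I * θ = 1 - (τ : ℂ) ^ 2) :
    θ = graphPt θ.re ∧ level θ.re = 1 - τ ^ 2 := by
  have hreal : 1 - (τ : ℂ) ^ 2 = ((1 - τ ^ 2 : ℝ) : ℂ) := by push_cast; rfl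
  have hgraph := eq_graphPt_of_im_eq_zero h0 (by rw [hθ, hreal, ofReal_im])
  refine ⟨hgraph, ?_⟩
  rw [hgraph, exp_I_mul_sub_graphPt h, hreal] at hθ
  exact_mod_cast hθ

lemma eq_graphPt_angle {τ : ℝ} {θ : ℂ} (h : θ.re ∈ Ioo 0 π)
    (hθ : cexp (I * θ) - I * θ = 1 - (τ : ℂ) ^ 2) : θ = graphPt (angle τ) := by
  have h' : θ.re ∈ Ico 0 π := ⟨h.1.le, h.2⟩
  obtain ⟨hgraph, hlevel⟩ := eq_graphPt_and_level_eq (Ico_subset_strip h') h.1.ne' hθ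
  rw [hgraph, strictAntiOn_level.injOn h' (angle_mem τ) (hlevel.trans (level_angle τ).symm)]

/-- The solution of `w e^w = -e^{τ² - 1}` in `regionR`: `w = -e^{iθ}` where
`e^{iθ} - iθ = 1 - τ²`. -/
noncomputable def lambertSol (τ : ℝ) : ℂ := -cexp (I * graphPt (angle τ))

lemma lambertSol_eq (τ : ℝ) : lambertSol τ = (τ : ℂ) ^ 2 - 1 - I * graphPt (angle τ) := by
  rw [lambertSol]
  linear_combination -exp_I_mul_sub_graphPt_angle τ

lemma lambertSol_mul_exp (τ : ℝ) :
    lambertSol τ * cexp (lambertSol τ) = -cexp ((τ : ℂ) ^ 2 - 1) := by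
  nth_rewrite 1 [lambertSol]
  rw [lambertSol_eq, neg_mul, ← Complex.exp_add, add_sub_cancel]

lemma lambertSol_im (τ : ℝ) : (lambertSol τ).im = -angle τ := by
  rw [lambertSol_eq, ← ofReal_pow, sub_im, sub_im, ofReal_im]
  simp

lemma lambertSol_re (τ : ℝ) : (lambertSol τ).re = -(Real.cos (angle τ) / sinc (angle τ)) := by
  have := exp_neg_height (Ico_subset_strip (angle_mem τ))
  simp [lambertSol, exp_re, this, div_eq_inv_mul]

lemma lambertSol_mem_regionR {τ : ℝ} (h : τ ≠ 0) : lambertSol τ ∈ regionR := by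
  have ha : angle τ ∈ Ioo 0 π := ⟨angle_pos h, (angle_mem τ).2⟩
  refine ⟨?_, ?_⟩
  · rw [lambertSol_re, neg_lt_neg_iff, div_lt_one (sinc_pos (Ico_subset_strip (angle_mem τ)))]
    exact lt_of_mul_lt_mul_left ((mul_cos_lt_sin ha).trans_eq (mul_sinc _).symm) ha.1.le
  · rw [lambertSol_im]
    exact ⟨neg_lt_neg ha.2, neg_neg_of_pos ha.1⟩

/-- `w ↦ i(1 - τ² + w)` carries the solutions of `w e^w = -e^{τ² - 1}` to those of
`e^{iθ} - iθ = 1 - τ²`. -/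
lemma eq_lambertSol {τ : ℝ} {w : ℂ} (h : w.im ∈ Ioo (-π) 0)
    (hw : w * cexp w = -cexp ((τ : ℂ) ^ 2 - 1)) : w = lambertSol τ := by
  have hI : I * (I * (1 - (τ : ℂ) ^ 2 + w)) = ((τ : ℂ) ^ 2 - 1) + -w := by
    linear_combination (1 - (τ : ℂ) ^ 2 + w) * I_mul_I
  have hθ : I * (1 - (τ : ℂ) ^ 2 + w) = graphPt (angle τ) := by
    apply eq_graphPt_angle
    · have hre : (I * (1 - (τ : ℂ) ^ 2 + w)).re = -w.im := by
        rw [I_mul_re, ← ofReal_pow, add_im, sub_im, ofReal_im]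
        simp
      rw [hre]
      exact ⟨neg_pos.2 h.2, neg_lt.1 h.1⟩
    · have hinv : cexp w * cexp (-w) = 1 := by rw [← Complex.exp_add]; simp
      rw [hI, Complex.exp_add]
      linear_combination cexp (-w) * hw - w * hinv
  rw [lambertSol_eq, ← hθ, hI]
  ring

/-! ### Line integrals and the Cauchy formula for rectangles -/

/-- The line integral `∫ φ(w) dw` along the path `u` from parameter `s` to parameter `t`. -/
noncomputable def lineIntegral (φ : ℂ → ℂ) (u : ℝ → ℂ) (s t : ℝ) : ℂ :=
  ∫ τ in s..t, φ (u τ) * deriv u τ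

section LineIntegral

variable {φ ψ : ℂ → ℂ} {u : ℝ → ℂ} {s t : ℝ}

lemma continuousOn_mul_deriv {K : Set ℝ} (hu : ContDiff ℝ 1 u) (hφ : ContinuousOn φ (u '' K)) :
    ContinuousOn (fun τ => φ (u τ) * deriv u τ) K :=
  (hφ.comp hu.continuous.continuousOn (mapsTo_image u K)).mul
    (hu.continuous_deriv le_rfl).continuousOn

lemma intervalIntegrable_mul_deriv (hu : ContDiff ℝ 1 u) (hφ : ContinuousOn φ (u '' uIcc s t)) :
    IntervalIntegrable (fun τ => φ (u τ) * deriv u τ) volume s t :=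
  (continuousOn_mul_deriv hu hφ).intervalIntegrable

lemma lineIntegral_congr (h : EqOn φ ψ (u '' uIcc s t)) :
    lineIntegral φ u s t = lineIntegral ψ u s t :=
  intervalIntegral.integral_congr fun τ hτ =>
    congrArg (· * deriv u τ) (h (mem_image_of_mem u hτ))

lemma lineIntegral_add (hu : ContDiff ℝ 1 u) (hφ : ContinuousOn φ (u '' uIcc s t))
    (hψ : ContinuousOn ψ (u '' uIcc s t)) :
    lineIntegral (fun w => φ w + ψ w) u s t = lineIntegral φ u s t + lineIntegral ψ u s t := by
  simp only [lineIntegral, add_mul]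
  exact intervalIntegral.integral_add (intervalIntegrable_mul_deriv hu hφ)
    (intervalIntegrable_mul_deriv hu hψ)

lemma lineIntegral_const_mul (c : ℂ) :
    lineIntegral (fun w => c * φ w) u s t = c * lineIntegral φ u s t := by
  simp only [lineIntegral, mul_assoc, intervalIntegral.integral_const_mul]

lemma lineIntegral_of_hasDerivAt {L : ℂ → ℂ} (hu : ContDiff ℝ 1 u)
    (hL : ∀ w ∈ u '' uIcc s t, HasDerivAt L (φ w) w) (hφ : ContinuousOn φ (u '' uIcc s t)) :
    lineIntegral φ u s t = L (u t) - L (u s) :=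
  intervalIntegral.integral_eq_sub_of_hasDerivAt (f := L ∘ u)
    (fun τ hτ => (hL _ (mem_image_of_mem u hτ)).comp_of_eq τ
      (hu.differentiable one_ne_zero τ).hasDerivAt rfl)
    (intervalIntegrable_mul_deriv hu hφ)

lemma continuousOn_inv_sub {K : Set ℂ} {a : ℂ} (h : a ∉ K) :
    ContinuousOn (fun w => (w - a)⁻¹) K :=
  ContinuousOn.inv₀ (by fun_prop) fun _ hw => sub_ne_zero.2 (ne_of_mem_of_not_mem hw h)

lemma hasDerivAt_log_mul_sub {c a w : ℂ} (h : c * (w - a) ∈ slitPlane) :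
    HasDerivAt (fun w => log (c * (w - a))) (w - a)⁻¹ w := by
  refine ((((hasDerivAt_id w).sub_const a).const_mul c).clog h).congr_deriv ?_
  rw [mul_one, ← div_div, div_self (left_ne_zero_of_mul (slitPlane_ne_zero h)), one_div, id]

lemma lineIntegral_inv_sub {a : ℂ} (c : ℂ) (hu : ContDiff ℝ 1 u)
    (h : ∀ τ ∈ uIcc s t, c * (u τ - a) ∈ slitPlane) :
    lineIntegral (fun w => (w - a)⁻¹) u s t = log (c * (u t - a)) - log (c * (u s - a)) := by
  refine lineIntegral_of_hasDerivAt (L := fun w => log (c * (w - a))) hu ?_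
    (continuousOn_inv_sub ?_)
  · rintro _ ⟨τ, hτ, rfl⟩
    exact hasDerivAt_log_mul_sub (h τ hτ)
  · rintro ⟨τ, hτ, rfl⟩
    exact slitPlane_ne_zero (h τ hτ) (by rw [sub_self, mul_zero])

lemma lineIntegral_div_sub {f : ℂ → ℂ} {p : ℂ} (hu : ContDiff ℝ 1 u)
    (hf : ContinuousOn f (u '' uIcc s t)) (hp : p ∉ u '' uIcc s t) :
    lineIntegral (fun w => f w / (w - p)) u s t =
      lineIntegral (dslope f p) u s t + f p * lineIntegral (fun w => (w - p)⁻¹) u s t := by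
  have hne : ∀ w ∈ u '' uIcc s t, w ≠ p := fun w hw => ne_of_mem_of_not_mem hw hp
  have hinv := continuousOn_inv_sub hp
  have hdslope : EqOn (dslope f p) (fun w => (f w - f p) * (w - p)⁻¹) (u '' uIcc s t) :=
    fun w hw => by rw [dslope_of_ne _ (hne w hw), slope_def_field, div_eq_mul_inv]
  rw [← lineIntegral_const_mul, ← lineIntegral_add (φ := dslope f p)
    (ψ := fun w => f p * (w - p)⁻¹) hu (((hf.sub continuousOn_const).mul hinv).congr hdslope)
    (continuousOn_const.mul hinv)]
  refine lineIntegral_congr fun w hw => ?_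
  simp only [hdslope hw]
  ring

end LineIntegral

lemma log_sub_log_neg {c : ℂ} (hc : 0 < c.im) : log c - log (-c) = π * I := by
  rw [log, log, norm_neg, arg_neg_eq_arg_sub_pi_of_im_pos hc]
  push_cast
  ring

lemma contDiff_horizontal (c : ℝ) : ContDiff ℝ 1 fun x : ℝ => (x : ℂ) + c * I :=
  ofRealCLM.contDiff.add contDiff_const

lemma contDiff_vertical (a : ℝ) : ContDiff ℝ 1 fun y : ℝ => (a : ℂ) + y * I :=
  contDiff_const.add (ofRealCLM.contDiff.mul contDiff_const)

lemma lineIntegral_horizontal (f : ℂ → ℂ) (a b c : ℝ) :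
    lineIntegral f (fun x : ℝ => (x : ℂ) + c * I) a b = ∫ x in a..b, f (x + c * I) := by
  have hderiv : deriv (fun x : ℝ => (x : ℂ) + c * I) = 1 := funext fun x =>
    ((hasDerivAt_id x).ofReal_comp.add_const _).deriv
  simp only [lineIntegral, hderiv, Pi.one_apply, mul_one]

lemma lineIntegral_vertical (f : ℂ → ℂ) (a c d : ℝ) :
    lineIntegral f (fun y : ℝ => (a : ℂ) + y * I) c d = I * ∫ y in c..d, f (a + y * I) := by
  have hderiv : deriv (fun y : ℝ => (a : ℂ) + y * I) = fun _ => I := funext fun y => by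
    simpa using (((hasDerivAt_id y).ofReal_comp.mul_const I).const_add (a : ℂ)).deriv
  simp only [lineIntegral, hderiv, intervalIntegral.integral_mul_const]
  exact mul_comm _ _

/-- The integral along the positively oriented boundary of the rectangle `[a, b] × [c, d]`. -/
noncomputable def rectIntegral (f : ℂ → ℂ) (a b c d : ℝ) : ℂ :=
  lineIntegral f (fun x : ℝ => (x : ℂ) + c * I) a b
    - lineIntegral f (fun x : ℝ => (x : ℂ) + d * I) a b
    + lineIntegral f (fun y : ℝ => (b : ℂ) + y * I) c d
    - lineIntegral f (fun y : ℝ => (a : ℂ) + y * I) c d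

section Rectangle

variable {a b c d : ℝ} {p : ℂ} {f : ℂ → ℂ}

lemma rectIntegral_eq_zero (hab : a ≤ b) (hcd : c ≤ d)
    (hf : DifferentiableOn ℂ f (Icc a b ×ℂ Icc c d)) : rectIntegral f a b c d = 0 := by
  have := integral_boundary_rect_eq_zero_of_differentiableOn f (a + c * I) (b + d * I)
    (by simpa [uIcc_of_le hab, uIcc_of_le hcd] using hf)
  simpa [rectIntegral, lineIntegral_horizontal, lineIntegral_vertical] using this

/-- On the left side, which crosses the cut of the logarithm, the primitive is `log (p - ξ)`. -/
lemma rectIntegral_inv_sub (hre : p.re ∈ Ioo a b) (him : p.im ∈ Ioo c d) :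
    rectIntegral (fun ξ => (ξ - p)⁻¹) a b c d = 2 * π * I := by
  have horizontal : ∀ y : ℝ, y ≠ p.im → ∀ τ ∈ uIcc a b, 1 * ((τ : ℂ) + y * I - p) ∈ slitPlane :=
    fun y hy τ _ => Or.inr (by simpa using sub_ne_zero.2 hy)
  have right : ∀ τ ∈ uIcc c d, 1 * ((b : ℂ) + τ * I - p) ∈ slitPlane :=
    fun τ _ => Or.inl (by simpa using hre.2)
  have left : ∀ τ ∈ uIcc c d, -1 * ((a : ℂ) + τ * I - p) ∈ slitPlane :=
    fun τ _ => Or.inl (by simpa using hre.1)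
  have upper := log_sub_log_neg (c := (a : ℂ) + d * I - p) (by simpa using him.2)
  have lower := log_sub_log_neg (c := -((a : ℂ) + c * I - p)) (by simpa using him.1)
  rw [neg_neg] at lower
  rw [rectIntegral, lineIntegral_inv_sub 1 (contDiff_horizontal c) (horizontal c him.1.ne),
    lineIntegral_inv_sub 1 (contDiff_horizontal d) (horizontal d him.2.ne'),
    lineIntegral_inv_sub 1 (contDiff_vertical b) right,
    lineIntegral_inv_sub (-1) (contDiff_vertical a) left]
  simp only [one_mul, neg_one_mul]
  linear_combination upper + lower

lemma rectIntegral_div_sub (hre : p.re ∈ Ioo a b) (him : p.im ∈ Ioo c d)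
    (hf : DifferentiableOn ℂ f (Icc a b ×ℂ Icc c d)) :
    rectIntegral (fun ξ => f ξ / (ξ - p)) a b c d = 2 * π * I * f p := by
  have hab := (hre.1.trans hre.2).le
  have hcd := (him.1.trans him.2).le
  have hnhds : Icc a b ×ℂ Icc c d ∈ 𝓝 p := by
    refine mem_of_superset ((isOpen_Ioo.reProdIm isOpen_Ioo).mem_nhds ⟨hre, him⟩) ?_
    exact fun ξ hξ => ⟨Ioo_subset_Icc_self hξ.1, Ioo_subset_Icc_self hξ.2⟩
  have hzero := rectIntegral_eq_zero hab hcd ((differentiableOn_dslope hnhds).2 hf)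
  have horizontal : ∀ y ∈ Icc c d,
      ContinuousOn f ((fun x : ℝ => (x : ℂ) + y * I) '' uIcc a b) := fun y hy =>
    hf.continuousOn.mono (by
      rintro _ ⟨t, ht, rfl⟩
      simpa [mem_reProdIm, hy, uIcc_of_le hab] using ht)
  have vertical : ∀ x ∈ Icc a b,
      ContinuousOn f ((fun y : ℝ => (x : ℂ) + y * I) '' uIcc c d) := fun x hx =>
    hf.continuousOn.mono (by
      rintro _ ⟨t, ht, rfl⟩
      simpa [mem_reProdIm, hx, uIcc_of_le hcd] using ht)
  have hinv := rectIntegral_inv_sub hre him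
  rw [rectIntegral] at hzero hinv ⊢
  rw [lineIntegral_div_sub (contDiff_horizontal c) (horizontal c ⟨le_rfl, hcd⟩),
    lineIntegral_div_sub (contDiff_horizontal d) (horizontal d ⟨hcd, le_rfl⟩),
    lineIntegral_div_sub (contDiff_vertical b) (vertical b ⟨hab, le_rfl⟩),
    lineIntegral_div_sub (contDiff_vertical a) (vertical a ⟨le_rfl, hab⟩)]
  · linear_combination hzero + f p * hinv
  · rintro ⟨t, -, rfl⟩; simp at hre
  · rintro ⟨t, -, rfl⟩; simp at hre
  · rintro ⟨t, -, rfl⟩; simp at him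
  · rintro ⟨t, -, rfl⟩; simp at him

end Rectangle

/-! ### The branch of the Lambert function -/

lemma norm_lambertKernel_le {z ξ : ℂ} (h1 : 1 ≤ ξ.re) (hz : 2 * ‖z‖ ≤ ξ.re) :
    ‖lambertKernel z ξ‖ ≤ 4 * Real.exp (-ξ.re) := by
  have hre : ξ.re ≤ ‖ξ‖ := re_le_norm ξ
  have hexp : 1 ≤ Real.exp ξ.re := Real.one_le_exp (by linarith)
  have hden : ‖ξ‖ * Real.exp ξ.re / 2 ≤ ‖ξ * cexp ξ - z‖ := by
    have := norm_sub_norm_le (ξ * cexp ξ) z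
    rw [norm_mul, norm_exp] at this
    nlinarith
  have hnum : ‖ξ + 1‖ ≤ 2 * ‖ξ‖ := (norm_add_le _ _).trans (by rw [norm_one]; linarith)
  have hpos : 0 < ‖ξ‖ * Real.exp ξ.re / 2 := by
    have : 0 < ‖ξ‖ := by linarith
    positivity
  have hinv : Real.exp (-ξ.re) * Real.exp ξ.re = 1 := by rw [← Real.exp_add]; simp
  rw [lambertKernel, norm_div, div_le_iff₀ (hpos.trans_le hden)]
  calc ‖ξ + 1‖ ≤ 2 * ‖ξ‖ := hnum
    _ = 4 * Real.exp (-ξ.re) * (‖ξ‖ * Real.exp ξ.re / 2) := by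
      linear_combination (-2 * ‖ξ‖) * hinv
    _ ≤ _ := by gcongr

section LambertKernel

variable {z p : ℂ}

lemma continuousOn_lambertKernel {K : Set ℂ} (h : ∀ ξ ∈ K, ξ * cexp ξ ≠ z) :
    ContinuousOn (lambertKernel z) K :=
  ContinuousOn.div (by fun_prop) (by fun_prop) fun ξ hξ => sub_ne_zero.2 (h ξ hξ)

lemma integrableOn_lambertKernel {y : ℝ} (h : ∀ t ≥ (-1 : ℝ), (t + y * I) * cexp (t + y * I) ≠ z) :
    IntegrableOn (fun t : ℝ => lambertKernel z (t + y * I)) (Ioi (-1)) := by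
  have hcont : ContinuousOn (fun t : ℝ => lambertKernel z (t + y * I)) (Ici (-1)) :=
    (continuousOn_lambertKernel (K := (fun t : ℝ => (t : ℂ) + y * I) '' Ici (-1))
      (by rintro _ ⟨t, ht, rfl⟩; exact h t ht)).comp (by fun_prop) (mapsTo_image _ _)
  refine integrableOn_Ici_iff_integrableOn_Ioi (by finiteness) |>.mp <|
    (hcont.locallyIntegrableOn measurableSet_Ici).integrableOn_of_isBigO_atTop
    (g := fun t : ℝ => Real.exp (-1 * t)) (.of_bound 4 ?_)
    ⟨Ioi 1, Ioi_mem_atTop 1, exp_neg_integrableOn_Ioi 1 one_pos⟩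
  filter_upwards [eventually_ge_atTop (1 : ℝ), eventually_ge_atTop (2 * ‖z‖)] with t h1 h2
  simpa using norm_lambertKernel_le (ξ := t + y * I) (by simpa using h1) (by simpa using h2)

lemma tendsto_lineIntegral_lambertKernel_right (z : ℂ) (c d : ℝ) :
    Tendsto (fun N : ℝ => lineIntegral (lambertKernel z) (fun y : ℝ => (N : ℂ) + y * I) c d)
      atTop (𝓝 0) := by
  have hbound : Tendsto (fun N : ℝ => 4 * Real.exp (-N) * |d - c|) atTop (𝓝 0) := by
    simpa using (Real.tendsto_exp_neg_atTop_nhds_zero.const_mul 4).mul_const |d - c|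
  refine squeeze_zero_norm' ?_ hbound
  filter_upwards [eventually_ge_atTop (1 : ℝ), eventually_ge_atTop (2 * ‖z‖)] with N h1 hz
  rw [lineIntegral_vertical, norm_mul, norm_I, one_mul]
  refine intervalIntegral.norm_integral_le_of_norm_le_const fun y _ => ?_
  simpa using norm_lambertKernel_le (ξ := N + y * I) (by simpa using h1) (by simpa using hz)

/-- The numerator `ξ + 1` of the kernel is chosen so that its residue at `p` is `p / z`. -/
lemma mul_rectIntegral_lambertKernel {a b c d : ℝ} (hre : p.re ∈ Ioo a b) (him : p.im ∈ Ioo c d)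
    (hp : p ≠ -1) (hpz : p * cexp p = z)
    (huniq : ∀ ξ ∈ Icc a b ×ℂ Icc c d, ξ * cexp ξ = z → ξ = p) :
    z * rectIntegral (lambertKernel z) a b c d = 2 * π * I * p := by
  set φ : ℂ → ℂ := fun ξ => ξ * cexp ξ - z with hφ
  have hφd : Differentiable ℂ φ := by fun_prop
  have hderiv : deriv φ p = (p + 1) * cexp p := by
    have : HasDerivAt φ (1 * cexp p + p * cexp p) p :=
      ((hasDerivAt_id p).mul (Complex.hasDerivAt_exp p)).sub_const z
    rw [this.deriv]
    ring
  have hp1 : p + 1 ≠ 0 := fun h => hp (eq_neg_of_add_eq_zero_left h)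
  have hmul : ∀ ξ, (ξ - p) * dslope φ p ξ = φ ξ := fun ξ => by
    simpa [hφ, hpz] using sub_smul_dslope φ p ξ
  have hdslope : Differentiable ℂ (dslope φ p) :=
    differentiableOn_univ.1 ((differentiableOn_dslope univ_mem).2 hφd.differentiableOn)
  have hne : ∀ ξ ∈ Icc a b ×ℂ Icc c d, dslope φ p ξ ≠ 0 := fun ξ hξ h => by
    have hξp : ξ = p := huniq ξ hξ (sub_eq_zero.1 (by simpa [h] using (hmul ξ).symm))
    rw [hξp, dslope_same, hderiv] at h
    exact mul_ne_zero hp1 (Complex.exp_ne_zero p) h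
  have hkernel : lambertKernel z = fun ξ => (ξ + 1) / dslope φ p ξ / (ξ - p) := by
    ext ξ
    rw [div_div, mul_comm (dslope φ p ξ), hmul, lambertKernel]
  have hdiff : DifferentiableOn ℂ (fun ξ => (ξ + 1) / dslope φ p ξ) (Icc a b ×ℂ Icc c d) :=
    DifferentiableOn.div (by fun_prop) hdslope.differentiableOn hne
  rw [hkernel, rectIntegral_div_sub hre him hdiff, dslope_same, hderiv, ← hpz]
  have := Complex.exp_ne_zero p
  field_simp

lemma tendsto_rectIntegral_lambertKernel
    (htop : ∀ t ≥ (-1 : ℝ), (t : ℂ) * cexp t ≠ z)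
    (hbottom : ∀ t ≥ (-1 : ℝ), (t - π * I) * cexp (t - π * I) ≠ z) :
    Tendsto (fun N => z * rectIntegral (lambertKernel z) (-1) N (-π) 0) atTop
      (𝓝 (2 * π * I * lambertW z)) := by
  have hneg : ∀ t : ℝ, (t : ℂ) - π * I = t + (-π : ℝ) * I := fun t => by push_cast; ring
  have lower := intervalIntegral_tendsto_integral_Ioi (-1)
    (integrableOn_lambertKernel fun t ht => by simpa only [hneg] using hbottom t ht) tendsto_id
  have upper := intervalIntegral_tendsto_integral_Ioi (-1) (integrableOn_lambertKernel (y := 0)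
    fun t ht => by simpa only [ofReal_zero, zero_mul, add_zero] using htop t ht) tendsto_id
  have right := tendsto_lineIntegral_lambertKernel_right z (-π) 0
  have htend := (((lower.sub upper).add right).sub_const
    (lineIntegral (lambertKernel z) (fun y : ℝ => ((-1 : ℝ) : ℂ) + y * I) (-π) 0)).const_mul z
  simp only [rectIntegral, lineIntegral_horizontal]
  convert htend using 2
  · rfl
  have hpi : (2 * π * I : ℂ) ≠ 0 := two_pi_I_ne_zero
  rw [lambertW, lineIntegral_vertical, intervalIntegral.integral_symm, ← mul_assoc,
    mul_div_cancel₀ _ hpi]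
  simp only [hneg, ofReal_zero, zero_mul, ofReal_neg, ofReal_one]
  ring_nf

theorem lambertW_eq_of_unique_root (hp : p ∈ regionR) (hpz : p * cexp p = z)
    (huniq : ∀ ξ ∈ Ici (-1) ×ℂ Icc (-π) 0, ξ * cexp ξ = z → ξ = p) : lambertW z = p := by
  have hπ := Real.pi_pos
  have hne1 : p ≠ -1 := by
    rintro rfl
    simpa using hp.1
  have htop : ∀ t ≥ (-1 : ℝ), (t : ℂ) * cexp t ≠ z := fun t ht h =>
    hp.2.2.ne (by simp [← huniq t ⟨by simpa using ht, by simp [hπ.le]⟩ h])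
  have hbottom : ∀ t ≥ (-1 : ℝ), (t - π * I) * cexp (t - π * I) ≠ z := fun t ht h =>
    hp.2.1.ne' (by simp [← huniq (t - π * I) ⟨by simpa using ht, by simp [hπ.le]⟩ h])
  have hlim := tendsto_rectIntegral_lambertKernel htop hbottom
  have hconst : Tendsto (fun N => z * rectIntegral (lambertKernel z) (-1) N (-π) 0) atTop
      (𝓝 (2 * π * I * p)) := by
    refine tendsto_const_nhds.congr' ?_
    filter_upwards [eventually_gt_atTop p.re] with N hN
    exact (mul_rectIntegral_lambertKernel ⟨hp.1, hN⟩ hp.2 hne1 hpz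
      fun ξ hξ => huniq ξ ⟨hξ.1.1, hξ.2⟩).symm
  exact mul_left_cancel₀ two_pi_I_ne_zero (tendsto_nhds_unique hlim hconst)

end LambertKernel

/-- On the line `Im ξ = -π` the value `ξ e^ξ` is not real, and on the real line it is at least
`-1/e`. -/
lemma eq_lambertSol_of_mem_closure {τ : ℝ} (hτ : τ ≠ 0) {ξ : ℂ} (him : ξ.im ∈ Icc (-π) 0)
    (h : ξ * cexp ξ = -cexp ((τ : ℂ) ^ 2 - 1)) : ξ = lambertSol τ := by
  have hreal : -cexp ((τ : ℂ) ^ 2 - 1) = ((-Real.exp (τ ^ 2 - 1) : ℝ) : ℂ) := by push_cast; rfl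
  refine eq_lambertSol ⟨him.1.lt_of_ne fun hbottom => ?_, him.2.lt_of_ne fun htop => ?_⟩ h
  · have himag := congrArg Complex.im h
    rw [hreal, ofReal_im, mul_im, exp_re, exp_im, ← hbottom] at himag
    simp [Real.pi_ne_zero] at himag
  · have hre := congrArg Complex.re h
    rw [hreal, ofReal_re, mul_re, exp_re, exp_im, htop] at hre
    simp only [Real.cos_zero, Real.sin_zero, mul_one, mul_zero, sub_zero] at hre
    have htangent := Real.add_one_le_exp (-ξ.re - 1)
    have hmul : Real.exp (-ξ.re - 1) * Real.exp ξ.re = Real.exp (-1) := by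
      rw [← Real.exp_add]
      ring_nf
    have hlt : Real.exp (-1) < Real.exp (τ ^ 2 - 1) :=
      Real.exp_lt_exp.2 (by linarith [sq_pos_of_ne_zero hτ])
    nlinarith [Real.exp_pos ξ.re]

theorem lambertW_eq_lambertSol {τ : ℝ} (hτ : τ ≠ 0) :
    lambertW (-cexp ((τ : ℂ) ^ 2 - 1)) = lambertSol τ :=
  lambertW_eq_of_unique_root (lambertSol_mem_regionR hτ) (lambertSol_mul_exp τ)
    fun _ hξ => eq_lambertSol_of_mem_closure hτ hξ.2

/-! ### The parametrization of the curve -/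

lemma angle_neg (τ : ℝ) : angle (-τ) = angle τ := by simp only [angle, neg_sq]

lemma angle_zero : angle 0 = 0 := by
  by_contra h
  have ha := angle_mem 0
  have := strictAntiOn_level (left_mem_Ico.2 Real.pi_pos) ha (ha.1.lt_of_ne' h)
  rw [level_angle, level_zero] at this
  simp at this

lemma neg_conj_graphPt (a : ℝ) : -(starRingEnd ℂ) (graphPt a) = graphPt (-a) := by
  apply Complex.ext <;> simp [height_neg]

lemma graphPt_zero : graphPt 0 = 0 := by simp [graphPt, height]

lemma thetaPlus_eq {τ : ℝ} (hτ : τ ≠ 0) : thetaPlus τ = graphPt (angle τ) := by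
  rw [thetaPlus, lambertW_eq_lambertSol hτ, lambertSol_eq]
  linear_combination (-graphPt (angle τ)) * I_mul_I

lemma theta_eq_graphPt_sign_mul (τ : ℝ) : theta τ = graphPt (Real.sign τ * angle τ) := by
  rcases lt_trichotomy τ 0 with h | h | h
  · rw [theta, if_neg h.not_gt, if_neg h.ne, thetaPlus_eq (neg_ne_zero.2 h.ne), neg_conj_graphPt,
      angle_neg, Real.sign_of_neg h, neg_one_mul]
  · simp [h, theta, graphPt_zero]
  · rw [theta, if_pos h, thetaPlus_eq h.ne', Real.sign_of_pos h, one_mul]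

lemma theta_re (τ : ℝ) : (theta τ).re = Real.sign τ * angle τ := by
  rw [theta_eq_graphPt_sign_mul, graphPt_re]

lemma theta_eq_graphPt (τ : ℝ) : theta τ = graphPt (theta τ).re := by
  rw [theta_re, theta_eq_graphPt_sign_mul]

lemma theta_im (τ : ℝ) : (theta τ).im = height (theta τ).re := by
  rw [theta_eq_graphPt, graphPt_im, graphPt_re]

@[simp] lemma theta_zero : theta 0 = 0 := by simp [theta]

@[simp] lemma theta_neg_re (τ : ℝ) : (theta (-τ)).re = -(theta τ).re := by
  rw [theta_re, theta_re, angle_neg, Real.sign_neg, neg_mul]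

@[simp] lemma theta_neg_im (τ : ℝ) : (theta (-τ)).im = (theta τ).im := by
  rw [theta_im, theta_im, theta_neg_re, height_neg]

lemma abs_theta_re (τ : ℝ) : |(theta τ).re| = angle τ := by
  rw [theta_re, abs_mul, abs_of_nonneg (angle_mem τ).1]
  rcases eq_or_ne τ 0 with rfl | h
  · simp [angle_zero]
  · rcases Real.sign_apply_eq_of_ne_zero τ h with h1 | h1 <;> simp [h1]

lemma theta_re_mem (τ : ℝ) : (theta τ).re ∈ Ioo (-π) π :=
  abs_lt.1 ((abs_theta_re τ).trans_lt (angle_mem τ).2)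

lemma mul_theta_re_pos {τ : ℝ} (h : τ ≠ 0) : 0 < τ * (theta τ).re := by
  rw [theta_re, ← mul_assoc, mul_comm τ]
  exact mul_pos (Real.sign_mul_pos_of_ne_zero τ h) (angle_pos h)

lemma theta_re_pos {τ : ℝ} (h : 0 < τ) : 0 < (theta τ).re :=
  pos_of_mul_pos_right (mul_theta_re_pos h.ne') h.le

lemma level_theta (τ : ℝ) : level (theta τ).re = 1 - τ ^ 2 := by
  rw [← level_abs, abs_theta_re, level_angle]

lemma theta_eq (τ : ℝ) : cexp (I * theta τ) - I * theta τ = 1 - (τ : ℂ) ^ 2 := by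
  rw [theta_eq_graphPt, exp_I_mul_sub_graphPt (theta_re_mem τ), level_theta]
  push_cast
  ring

lemma abs_theta_re_lt_iff {s t : ℝ} : |(theta s).re| < |(theta t).re| ↔ |s| < |t| := by
  rw [← level_lt_level_iff (theta_re_mem s) (theta_re_mem t), level_theta, level_theta,
    sub_lt_sub_iff_left, sq_lt_sq]

lemma eq_theta {τ : ℝ} {θ : ℂ} (h : θ.re ∈ Ioo (-π) π) (hpos : 0 < τ * θ.re)
    (hθ : cexp (I * θ) - I * θ = 1 - (τ : ℂ) ^ 2) : θ = theta τ := by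
  obtain ⟨hgraph, hlevel⟩ := eq_graphPt_and_level_eq h (right_ne_zero_of_mul hpos.ne') hθ
  have habs : |θ.re| = |(theta τ).re| := by
    refine strictAntiOn_level.injOn (abs_mem_Ico h) (abs_mem_Ico (theta_re_mem τ)) ?_
    rw [level_abs, level_abs, hlevel, level_theta]
  have hre : θ.re = (theta τ).re := by
    rcases abs_eq_abs.1 habs with h1 | h1
    · exact h1
    · have := mul_theta_re_pos (left_ne_zero_of_mul hpos.ne')
      rw [h1] at hpos
      linarith
  rw [hgraph, hre, ← theta_eq_graphPt]

lemma theta_injective : Function.Injective theta := by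
  intro s t hst
  have hsq : s ^ 2 = t ^ 2 := by
    have := level_theta s
    rw [hst, level_theta t] at this
    linarith
  rcases sq_eq_sq_iff_eq_or_eq_neg.1 hsq with h | h
  · exact h
  · have hre : -(theta t).re = (theta t).re := by rw [← theta_neg_re, ← h, hst]
    have ht : t = 0 := by
      by_contra ht
      have := mul_theta_re_pos ht
      simp [self_eq_neg.1 hre.symm] at this
    rw [h, ht, neg_zero]

lemma exists_theta_eq {a : ℝ} (ha : a ∈ Ioo (-π) π) : ∃ τ, theta τ = graphPt a := by
  rcases eq_or_ne a 0 with rfl | h0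
  · exact ⟨0, by simp [graphPt_zero]⟩
  have hlt : level a < 1 := by
    rw [← level_zero, level_lt_level_iff ⟨neg_lt_zero.2 Real.pi_pos, Real.pi_pos⟩ ha]
    simpa using h0
  have hsq : (Real.sign a * √(1 - level a)) ^ 2 = 1 - level a := by
    rw [mul_pow, Real.sq_sqrt (by linarith)]
    rcases Real.sign_apply_eq_of_ne_zero a h0 with h | h <;> simp [h]
  refine ⟨Real.sign a * √(1 - level a), (eq_theta (by simpa using ha) ?_ ?_).symm⟩
  · rw [graphPt_re, mul_right_comm]
    exact mul_pos (Real.sign_mul_pos_of_ne_zero a h0) (Real.sqrt_pos.2 (by linarith))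
  · rw [exp_I_mul_sub_graphPt ha, ← ofReal_pow, hsq]
    push_cast
    ring

theorem bijOn_theta : BijOn theta univ curveC := by
  refine ⟨fun τ _ => ?_, theta_injective.injOn, ?_⟩
  · rcases eq_or_ne τ 0 with rfl | h0
    · exact Or.inl theta_zero
    · refine Or.inr ⟨theta_re_mem τ, right_ne_zero_of_mul (mul_theta_re_pos h0).ne', ?_⟩
      rw [theta_eq_graphPt, exp_I_mul_sub_graphPt (theta_re_mem τ), ofReal_im]
  · rintro θ (rfl | ⟨hre, h0, him⟩)
    · exact ⟨0, mem_univ _, theta_zero⟩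
    · obtain ⟨τ, hτ⟩ := exists_theta_eq hre
      exact ⟨τ, mem_univ _, hτ.trans (eq_graphPt_of_im_eq_zero h0 him).symm⟩

theorem mem_regionOmega_and_eq_iff {τ : ℝ} (hτ : 0 < τ) (ϑ : ℂ) :
    (ϑ ∈ regionOmega ∧ cexp (I * ϑ) - I * ϑ = 1 - (τ : ℂ) ^ 2) ↔ ϑ = theta τ := by
  constructor
  · rintro ⟨hmem, heq⟩
    exact eq_theta (Ioo_subset_Ioo_left (neg_nonpos.2 Real.pi_pos.le) hmem.1)
      (mul_pos hτ hmem.1.1) heq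
  · rintro rfl
    have hre := theta_re_pos hτ
    refine ⟨⟨⟨hre, (theta_re_mem τ).2⟩, ?_⟩, theta_eq τ⟩
    rw [theta_im]
    exact height_neg_of_ne_zero (theta_re_mem τ) hre.ne'

theorem mem_regionR_and_mul_exp_eq_iff {τ : ℝ} (hτ : τ ≠ 0) (w : ℂ) :
    (w ∈ regionR ∧ w * cexp w = -cexp ((τ : ℂ) ^ 2 - 1)) ↔
      w = lambertW (-cexp ((τ : ℂ) ^ 2 - 1)) := by
  rw [lambertW_eq_lambertSol hτ]
  constructor
  · rintro ⟨hmem, heq⟩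
    exact eq_lambertSol hmem.2 heq
  · rintro rfl
    exact ⟨lambertSol_mem_regionR hτ, lambertSol_mul_exp τ⟩

/-! ### Smoothness of the parametrization -/

lemma exists_analyticAt_rightInverse {f : ℂ → ℂ} {a : ℂ} (hf : AnalyticAt ℂ f a)
    (hf' : deriv f a ≠ 0) :
    ∃ σ : ℂ → ℂ, AnalyticAt ℂ σ (f a) ∧ σ (f a) = a ∧ HasDerivAt σ (deriv f a)⁻¹ (f a) ∧
      ∀ᶠ y in 𝓝 (f a), f (σ y) = y :=
  ⟨_, hf.analyticAt_localInverse hf', HasStrictFDerivAt.localInverse_apply_image ..,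
    (hf.hasStrictDerivAt.to_localInverse hf').hasDerivAt,
    hf.hasStrictDerivAt.eventually_right_inverse hf'⟩

/-- If `f(z) = r² z² (1 + O(z))`, then `q(z) = r z (1 + O(z))^{1/2}`. -/
lemma exists_analyticAt_sq_eq {f : ℂ → ℂ} {r : ℂ} (hf : AnalyticAt ℂ f 0) (h0 : f 0 = 0)
    (h1 : deriv f 0 = 0) (h2 : iteratedDeriv 2 f 0 = 2 * r ^ 2) (hr : r ≠ 0) :
    ∃ q : ℂ → ℂ, AnalyticAt ℂ q 0 ∧ q 0 = 0 ∧ deriv q 0 = r ∧ ∀ z, q z ^ 2 = f z := by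
  obtain ⟨F, hF, hfF⟩ := hf.exists_eq_sum_add_pow_mul 3
  set κ : ℂ → ℂ := fun z => 1 + z * (F z / r ^ 2) with hκ
  have hκa : AnalyticAt ℂ κ 0 := by fun_prop (disch := simpa using hr)
  have hκ0 : κ 0 = 1 := by simp [hκ]
  have hfκ : ∀ z, f z = r ^ 2 * z ^ 2 * κ z := fun z => by
    rw [hfF z]
    simp [Finset.sum_range_succ, h0, h1, h2, hκ]
    field_simp
  have hroot : AnalyticAt ℂ (fun z => κ z ^ (1 / 2 : ℂ)) 0 :=
    hκa.cpow analyticAt_const (by rw [hκ0]; exact one_mem_slitPlane)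
  refine ⟨fun z => r * z * κ z ^ (1 / 2 : ℂ), by fun_prop, by simp, ?_, fun z => ?_⟩
  · have := ((hasDerivAt_id (0 : ℂ)).const_mul r).mul hroot.differentiableAt.hasDerivAt
    exact this.deriv.trans (by simp [hκ0])
  · rw [hfκ, mul_pow, mul_pow, ← cpow_nat_mul]
    simp

lemma eventually_mul_pos_of_hasDerivAt {h : ℝ → ℝ} {d : ℝ} (hd : 0 < d) (h0 : h 0 = 0)
    (hh : HasDerivAt h d 0) : ∀ᶠ τ in 𝓝[≠] 0, 0 < τ * h τ := by
  filter_upwards [hh.tendsto_slope.eventually_const_lt hd, self_mem_nhdsWithin] with τ hslope hτ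
  rw [slope_def_field, h0, sub_zero, sub_zero] at hslope
  have hsq : 0 < τ ^ 2 := sq_pos_of_ne_zero hτ
  calc 0 < τ ^ 2 * (h τ / τ) := mul_pos hsq hslope
    _ = τ * h τ := by field_simp [show τ ≠ 0 from hτ]

lemma theta_eventuallyEq {σ : ℝ → ℂ} {τ₀ : ℝ} (hσ : ContinuousAt σ τ₀) (h0 : σ τ₀ = theta τ₀)
    (hpos : ∀ᶠ τ in 𝓝[≠] τ₀, 0 < τ * (σ τ).re)
    (heq : ∀ᶠ τ : ℝ in 𝓝 τ₀, cexp (I * σ τ) - I * σ τ = 1 - (τ : ℂ) ^ 2) :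
    theta =ᶠ[𝓝 τ₀] σ := by
  have hstrip : ∀ᶠ τ in 𝓝 τ₀, (σ τ).re ∈ Ioo (-π) π :=
    (continuous_re.continuousAt.comp hσ).eventually_mem
      (isOpen_Ioo.mem_nhds (by simpa [h0] using theta_re_mem τ₀))
  filter_upwards [eventually_nhdsWithin_iff.1 hpos, heq, hstrip] with τ h1 h2 h3
  rcases eq_or_ne τ τ₀ with rfl | hne
  · exact h0.symm
  · exact (eq_theta h3 (h1 hne) h2).symm

lemma hasDerivAt_exp_I_mul_sub (θ : ℂ) :
    HasDerivAt (fun ϑ => cexp (I * ϑ) - I * ϑ) (I * (cexp (I * θ) - 1)) θ := by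
  have h : HasDerivAt (fun ϑ => I * ϑ) I θ := by simpa using (hasDerivAt_id θ).const_mul I
  exact (h.cexp.sub h).congr_deriv (by ring)

lemma exp_theta_im (τ : ℝ) : (cexp (I * theta τ)).im = (theta τ).re := by
  have := congrArg Complex.im (theta_eq τ)
  rw [← ofReal_pow, sub_im, sub_im, ofReal_im, one_im, I_mul_im] at this
  linarith

lemma contDiffAt_theta_of_ne_zero {τ : ℝ} (h0 : τ ≠ 0) : ContDiffAt ℝ ∞ theta τ := by
  set f : ℂ → ℂ := fun ϑ => cexp (I * ϑ) - I * ϑ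
  have hpos := mul_theta_re_pos h0
  have hderiv : deriv f (theta τ) ≠ 0 := by
    rw [(hasDerivAt_exp_I_mul_sub _).deriv]
    refine mul_ne_zero I_ne_zero fun h => right_ne_zero_of_mul hpos.ne' ?_
    rw [← exp_theta_im, sub_eq_zero.1 h, one_im]
  obtain ⟨σ, hσ, hσ0, -, hright⟩ :=
    exists_analyticAt_rightInverse (f := f) (a := theta τ) (by fun_prop) hderiv
  rw [show f (theta τ) = 1 - (τ : ℂ) ^ 2 from theta_eq τ] at hσ hσ0 hright
  have hpath : ContDiff ℝ ∞ fun t : ℝ => (1 : ℂ) - (t : ℂ) ^ 2 :=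
    contDiff_const.sub (ofRealCLM.contDiff.pow 2)
  have hcomp : ContDiffAt ℝ ∞ (fun t : ℝ => σ (1 - (t : ℂ) ^ 2)) τ :=
    ContDiffAt.comp τ (hσ.contDiffAt.restrict_scalars ℝ) hpath.contDiffAt
  have hcont : ContinuousAt (fun t : ℝ => t * (σ (1 - (t : ℂ) ^ 2)).re) τ :=
    continuousAt_id.mul (continuous_re.continuousAt.comp hcomp.continuousAt)
  refine hcomp.congr_of_eventuallyEq (theta_eventuallyEq hcomp.continuousAt hσ0 ?_
    ((hpath.continuous.tendsto τ).eventually hright))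
  exact (hcont.eventually (lt_mem_nhds (by simpa [hσ0] using hpos))).filter_mono
    nhdsWithin_le_nhds

/-- At the saddle point `1 - (e^{iθ} - iθ) = θ²/2 + O(θ³)`, and `θ(τ)` is the inverse of a square
root of this function. -/
lemma contDiffAt_theta_zero_and_deriv : ContDiffAt ℝ ∞ theta 0 ∧ deriv theta 0 = √2 := by
  set f : ℂ → ℂ := fun ϑ => 1 - (cexp (I * ϑ) - I * ϑ) with hf
  have hderiv : deriv f = fun θ => -(I * (cexp (I * θ) - 1)) := funext fun θ =>
    ((hasDerivAt_exp_I_mul_sub θ).const_sub 1).deriv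
  have hderiv2 : iteratedDeriv 2 f 0 = 1 := by
    have hlin : HasDerivAt (fun ϑ => I * ϑ) I 0 := by simpa using (hasDerivAt_id 0).const_mul I
    rw [iteratedDeriv_succ, iteratedDeriv_one, hderiv,
      ((hlin.cexp.sub_const 1).const_mul I).fun_neg.deriv]
    simp
  have hsqrt : (√2 : ℂ) ≠ 0 := by simp
  have hsq : (√2 : ℂ) ^ 2 = 2 := by exact_mod_cast Real.sq_sqrt zero_le_two
  obtain ⟨q, hq, hq0, hq', hqf⟩ := exists_analyticAt_sq_eq (f := f) (r := (√2 : ℂ)⁻¹)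
    (by fun_prop) (by simp [hf]) (by simp [hderiv]) (by rw [hderiv2, inv_pow, hsq]; norm_num)
    (inv_ne_zero hsqrt)
  obtain ⟨σ, hσ, hσ0, hσ', hright⟩ :=
    exists_analyticAt_rightInverse hq (by rw [hq']; exact inv_ne_zero hsqrt)
  rw [hq0] at hσ hσ0 hσ' hright
  rw [hq', inv_inv] at hσ'
  have hcomp : ContDiffAt ℝ ∞ (fun t : ℝ => σ t) 0 :=
    ContDiffAt.comp (0 : ℝ) (g := σ) (f := fun t : ℝ => (t : ℂ))
      (by rw [ofReal_zero]; exact hσ.contDiffAt.restrict_scalars ℝ) ofRealCLM.contDiff.contDiffAt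
  have hcomp' : HasDerivAt (fun t : ℝ => σ t) √2 0 := hσ'.comp_ofReal
  have hpos : ∀ᶠ t : ℝ in 𝓝[≠] 0, 0 < t * (σ t).re :=
    eventually_mul_pos_of_hasDerivAt (d := √2) (by positivity) (by simp [hσ0])
      (reCLM.hasFDerivAt.comp_hasDerivAt 0 hcomp')
  have heq : theta =ᶠ[𝓝 0] fun t : ℝ => σ t := by
    refine theta_eventuallyEq hcomp.continuousAt (by simp [hσ0]) hpos ?_
    filter_upwards [(continuous_ofReal.tendsto' 0 0 ofReal_zero).eventually hright] with t ht
    rw [← ht, hqf, hf]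
    simp only [ht]
    ring
  exact ⟨hcomp.congr_of_eventuallyEq heq, heq.deriv_eq.trans hcomp'.deriv⟩

theorem contDiff_theta : ContDiff ℝ ∞ theta := by
  refine contDiff_iff_contDiffAt.2 fun τ => ?_
  rcases eq_or_ne τ 0 with rfl | h
  · exact contDiffAt_theta_zero_and_deriv.1
  · exact contDiffAt_theta_of_ne_zero h

lemma hasDerivAt_theta (τ : ℝ) : HasDerivAt theta (deriv theta τ) τ :=
  (contDiff_theta.differentiable (by simp) τ).hasDerivAt

/-- Differentiating `e^{iθ} - iθ = 1 - τ²` gives `θ' = 2iτ / (e^{iθ} - 1)`, where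
`Im (e^{iθ} - 1) = Re θ` has the sign of `τ`. -/
theorem deriv_theta_re_pos (τ : ℝ) : 0 < (deriv theta τ).re := by
  rcases eq_or_ne τ 0 with rfl | h0
  · rw [contDiffAt_theta_zero_and_deriv.2, ofReal_re]
    positivity
  set u := cexp (I * theta τ) - 1 with hu
  have hpos := mul_theta_re_pos h0
  have him : u.im = (theta τ).re := by rw [hu, sub_im, exp_theta_im, one_im, sub_zero]
  have hderiv : I * u * deriv theta τ = -(2 * τ) := by
    have hleft := (hasDerivAt_exp_I_mul_sub (theta τ)).comp τ (hasDerivAt_theta τ)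
    have hright : HasDerivAt (fun τ : ℝ => 1 - (τ : ℂ) ^ 2) (-(2 * (τ : ℂ))) τ := by
      simpa using ((hasDerivAt_id τ).ofReal_comp.pow 2).const_sub 1
    exact (hleft.congr_of_eventuallyEq (.of_forall fun t => (theta_eq t).symm)).unique hright
  have hnorm : 0 < normSq u := normSq_pos.2 fun h => by
    rw [← him, h, zero_im, mul_zero] at hpos
    exact hpos.false
  have hre : (deriv theta τ).re * normSq u = 2 * (τ * (theta τ).re) := by
    have : deriv theta τ * normSq u = I * (2 * τ) * (starRingEnd ℂ) u := by
      rw [← mul_conj]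
      linear_combination (-I * (starRingEnd ℂ) u) * hderiv
        + deriv theta τ * u * (starRingEnd ℂ) u * I_mul_I
    rw [← re_mul_ofReal, this, ← him]
    simp [mul_assoc]
  exact pos_of_mul_pos_left (hre ▸ mul_pos two_pos hpos) hnorm.le

/-! ### Residues and partial fractions -/

/-- `c` is the residue of `f` at the isolated singularity `p`, expressed by the existence of a
primitive of `f z - c / (z - p)` on a punctured neighbourhood of `p`. -/
def HasResidue (f : ℂ → ℂ) (p c : ℂ) : Prop :=
  (∀ᶠ z in 𝓝[≠] p, DifferentiableAt ℂ f z) ∧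
    ∃ K : ℂ → ℂ, ∀ᶠ z in 𝓝[≠] p, HasDerivAt K (f z - c / (z - p)) z

lemma exists_primitive_of_analyticAt {s : ℂ → ℂ} {p : ℂ} (hs : AnalyticAt ℂ s p) :
    ∃ K : ℂ → ℂ, ∀ᶠ z in 𝓝 p, HasDerivAt K (s z) z := by
  obtain ⟨δ, hδ, hball⟩ := Metric.eventually_nhds_iff_ball.1 hs.eventually_analyticAt
  obtain ⟨K, hK⟩ := DifferentiableOn.isExactOn_ball fun z hz =>
    (hball z hz).differentiableAt.differentiableWithinAt
  exact ⟨K, (Metric.eventually_nhds_iff_ball.2 ⟨δ, hδ, hK⟩)⟩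

lemma hasResidue_of_sub_analyticAt {f K s : ℂ → ℂ} {p c : ℂ}
    (hf : ∀ᶠ z in 𝓝[≠] p, DifferentiableAt ℂ f z) (hs : AnalyticAt ℂ s p)
    (hK : ∀ᶠ z in 𝓝[≠] p, HasDerivAt K (f z - c / (z - p) - s z) z) : HasResidue f p c := by
  obtain ⟨S, hS⟩ := exists_primitive_of_analyticAt hs
  refine ⟨hf, fun z => K z + S z, ?_⟩
  filter_upwards [hK, nhdsWithin_le_nhds hS] with z hKz hSz
  exact (hKz.add hSz).congr_deriv (sub_add_cancel _ _)

namespace HasResidue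

variable {f : ℂ → ℂ} {p c : ℂ}

lemma eventually_circleIntegral_eq (h : HasResidue f p c) :
    ∀ᶠ r in 𝓝[>] (0 : ℝ), ∮ z in C(p, r), f z = 2 * π * I * c := by
  obtain ⟨hf, K, hK⟩ := h
  obtain ⟨δ, hδ, hball⟩ :=
    Metric.eventually_nhds_iff_ball.1 (eventually_nhdsWithin_iff.1 (hf.and hK))
  filter_upwards [Ioo_mem_nhdsGT hδ] with r hr
  have hsphere : ∀ z ∈ Metric.sphere p r,
      DifferentiableAt ℂ f z ∧ HasDerivAt K (f z - c / (z - p)) z := fun z hz =>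
    hball z (Metric.sphere_subset_ball hr.2 hz) (Metric.ne_of_mem_sphere hz hr.1.ne')
  have hfi : CircleIntegrable f p r := ContinuousOn.circleIntegrable hr.1.le fun z hz =>
    (hsphere z hz).1.continuousAt.continuousWithinAt
  have hci : CircleIntegrable (fun z => c / (z - p)) p r :=
    ContinuousOn.circleIntegrable hr.1.le <| ContinuousOn.div (by fun_prop) (by fun_prop)
      fun z hz => sub_ne_zero.2 (Metric.ne_of_mem_sphere hz hr.1.ne')
  have hzero : ∮ z in C(p, r), (f z - c / (z - p)) = 0 :=
    circleIntegral.integral_eq_zero_of_hasDerivWithinAt hr.1.le fun z hz =>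
      (hsphere z hz).2.hasDerivWithinAt
  rw [circleIntegral.integral_sub hfi hci, sub_eq_zero] at hzero
  simp only [hzero, div_eq_mul_inv, circleIntegral.integral_const_mul,
    circleIntegral.integral_sub_center_inv p hr.1.ne']
  exact mul_comm _ _

lemma residue_eq (h : HasResidue f p c) : residue f p = c := by
  refine Tendsto.limUnder_eq (tendsto_const_nhds.congr' ?_)
  filter_upwards [h.eventually_circleIntegral_eq] with r hr
  rw [hr, inv_mul_cancel_left₀ two_pi_I_ne_zero]

lemma const_mul (h : HasResidue f p c) (b : ℂ) : HasResidue (fun z => b * f z) p (b * c) := by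
  obtain ⟨hf, K, hK⟩ := h
  refine ⟨hf.mono fun z hz => hz.const_mul b, fun z => b * K z, hK.mono fun z hz => ?_⟩
  rw [mul_div_assoc, ← mul_sub]
  exact hz.const_mul b

lemma eq_iteratedDeriv {φ : ℂ → ℂ} {n : ℕ} (h : HasResidue (fun z => φ z / (z - p) ^ (n + 1)) p c)
    (hφ : AnalyticAt ℂ φ p) : c = iteratedDeriv n φ p / n.factorial := by
  obtain ⟨δ, hδ, hball⟩ := Metric.eventually_nhds_iff_ball.1 hφ.eventually_analyticAt
  obtain ⟨r, hrc, hr⟩ := (h.eventually_circleIntegral_eq.and (Ioo_mem_nhdsGT hδ)).exists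
  have hcauchy := DifferentiableOn.circleIntegral_one_div_sub_center_pow_smul hr.1 n fun z hz =>
    (hball z (Metric.closedBall_subset_ball hr.2 hz)).differentiableAt.differentiableWithinAt
  simp only [smul_eq_mul, one_div_mul_eq_div] at hcauchy
  rw [hcauchy, mul_div_right_comm, mul_assoc, mul_comm_div] at hrc
  exact (mul_left_cancel₀ two_pi_I_ne_zero (by linear_combination hrc)).symm

/-- Writing `e ϑ - e θ = (ϑ - θ) d ϑ`, the logarithmic derivative of `e - e θ` is
`1 / (ϑ - θ) + d' / d`, with `d'/d` analytic. -/
lemma deriv_mul_comp {e : ℂ → ℂ} {θ : ℂ} (h : HasResidue f (e θ) c) (he : AnalyticAt ℂ e θ)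
    (hθ : deriv e θ ≠ 0) : HasResidue (fun ϑ => deriv e ϑ * f (e ϑ)) θ c := by
  obtain ⟨hf, K, hK⟩ := h
  set d : ℂ → ℂ := dslope e θ
  have hd : AnalyticAt ℂ d θ := he.elim fun _ hp => ⟨_, hp.has_fpower_series_dslope_fslope⟩
  have hdθ : d θ ≠ 0 := (dslope_same e θ).trans_ne hθ
  have htendsto : Tendsto e (𝓝[≠] θ) (𝓝[≠] (e θ)) :=
    he.differentiableAt.hasDerivAt.tendsto_nhdsNE hθ
  have hanalytic : ∀ᶠ ϑ in 𝓝[≠] θ, AnalyticAt ℂ e ϑ ∧ AnalyticAt ℂ d ϑ ∧ d ϑ ≠ 0 :=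
    nhdsWithin_le_nhds <| he.eventually_analyticAt.and
      (hd.eventually_analyticAt.and (hd.continuousAt.eventually_ne hdθ))
  refine hasResidue_of_sub_analyticAt (K := K ∘ e) (s := fun ϑ => c * (deriv d ϑ / d ϑ)) ?_
    (analyticAt_const.mul (hd.deriv.div hd hdθ)) ?_
  · filter_upwards [htendsto.eventually hf, hanalytic] with ϑ hfϑ hϑ
    exact hϑ.1.deriv.differentiableAt.mul (hfϑ.comp ϑ hϑ.1.differentiableAt)
  · filter_upwards [htendsto.eventually hK, hanalytic, self_mem_nhdsWithin]
      with ϑ hKϑ ⟨heϑ, hdϑ, hdϑ0⟩ hϑ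
    have hne : ϑ - θ ≠ 0 := sub_ne_zero.2 hϑ
    have hfactor : e = fun ϑ => e θ + (ϑ - θ) * d ϑ := funext fun ϑ => by
      rw [← smul_eq_mul, sub_smul_dslope, add_sub_cancel]
    have hderiv : deriv e ϑ = d ϑ + (ϑ - θ) * deriv d ϑ := by
      have := (((hasDerivAt_id ϑ).sub_const θ).mul hdϑ.differentiableAt.hasDerivAt).const_add (e θ)
      rw [hfactor]
      simpa using this.deriv
    have hsub : e ϑ - e θ = (ϑ - θ) * d ϑ := by rw [← smul_eq_mul, sub_smul_dslope]
    refine (hKϑ.comp ϑ heϑ.differentiableAt.hasDerivAt).congr_deriv ?_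
    rw [hsub, hderiv]
    field_simp
    ring

end HasResidue

section PrincipalPart

variable {f h : ℂ → ℂ} {a : ℂ}

lemma hasDerivAt_neg_div_mul_pow_inv {N : ℕ} (hN : N ≠ 0) (c : ℂ) {z : ℂ} (hz : z ≠ a) :
    HasDerivAt (fun z => -(c / N) * ((z - a) ^ N)⁻¹) (c / (z - a) ^ (N + 1)) z := by
  have hza : z - a ≠ 0 := sub_ne_zero.2 hz
  have hpow : HasDerivAt (fun z => (z - a) ^ N) (N * (z - a) ^ (N - 1) * 1) z :=
    ((hasDerivAt_id z).sub_const a).pow N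
  refine ((hpow.inv (pow_ne_zero _ hza)).const_mul (-(c / N))).congr_deriv ?_
  obtain ⟨M, rfl⟩ := Nat.exists_eq_succ_of_ne_zero hN
  have hM : ((M.succ : ℕ) : ℂ) ≠ 0 := by exact_mod_cast hN
  simp only [Nat.succ_eq_add_one, Nat.add_sub_cancel] at hM ⊢
  field_simp
  ring

lemma div_sub_pow_succ_eq_add_dslope {N : ℕ} {z : ℂ} (hz : z ≠ a) :
    h z / (z - a) ^ (N + 1) = h a / (z - a) ^ (N + 1) + dslope h a z / (z - a) ^ N := by
  have hza : z - a ≠ 0 := sub_ne_zero.2 hz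
  rw [dslope_of_ne _ hz, slope_def_field]
  field_simp
  ring

lemma exists_principalPart_of_div_pow (N : ℕ) (hh : AnalyticAt ℂ h a) :
    ∃ (c : ℂ) (D k : ℂ → ℂ), (∀ z ≠ a, DifferentiableAt ℂ D z) ∧ (N = 0 → D = 0) ∧
      AnalyticAt ℂ k a ∧ ∀ z ≠ a, h z / (z - a) ^ (N + 1) = c / (z - a) + deriv D z + k z := by
  have hdslope {h : ℂ → ℂ} (hh : AnalyticAt ℂ h a) : AnalyticAt ℂ (dslope h a) a :=
    hh.elim fun _ hp => ⟨_, hp.has_fpower_series_dslope_fslope⟩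
  induction N generalizing h with
  | zero =>
    refine ⟨h a, 0, dslope h a, fun z _ => differentiableAt_const _, fun _ => rfl, hdslope hh,
      fun z hz => ?_⟩
    rw [div_sub_pow_succ_eq_add_dslope hz, deriv_zero]
    simp
  | succ N ih =>
    obtain ⟨c, D, k, hD, -, hk, heq⟩ := ih (hdslope hh)
    have hderiv {z : ℂ} (hz : z ≠ a) := (hasDerivAt_neg_div_mul_pow_inv N.succ_ne_zero (h a)
      hz).add (hD z hz).hasDerivAt
    refine ⟨c, _, k, fun z hz => (hderiv hz).differentiableAt,
      fun h0 => absurd h0 N.succ_ne_zero, hk, fun z hz => ?_⟩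
    rw [(hderiv hz).deriv, div_sub_pow_succ_eq_add_dslope hz, heq z hz]
    simp only [Nat.succ_eq_add_one]
    ring

lemma exists_eq_div_sub_of_neg_one_le_order (hf : MeromorphicAt f a)
    (horder : -1 ≤ meromorphicOrderAt f a) :
    ∃ h : ℂ → ℂ, AnalyticAt ℂ h a ∧ ∀ᶠ z in 𝓝[≠] a, f z = h z / (z - a) ^ (0 + 1) := by
  have hsub : MeromorphicAt (fun z => z - a) a := by fun_prop
  have hmul : 0 ≤ meromorphicOrderAt (fun z => (z - a) * f z) a := by
    rw [fun_meromorphicOrderAt_mul hsub hf, meromorphicOrderAt_id_sub_const]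
    calc (0 : WithTop ℤ) = 1 + -1 := rfl
      _ ≤ _ := by gcongr
  obtain ⟨h, hh, heq⟩ := (hsub.fun_mul hf).meromorphicOrderAt_nonneg_iff.1 hmul
  refine ⟨h, hh, ?_⟩
  filter_upwards [heq, self_mem_nhdsWithin] with z hz hza
  rw [← hz, zero_add, pow_one, mul_div_cancel_left₀ _ (sub_ne_zero.2 hza)]

lemma exists_principalPart (hf : MeromorphicAt f a) :
    ∃ (c : ℂ) (D : ℂ → ℂ), (∀ z ≠ a, DifferentiableAt ℂ D z) ∧
      (-1 ≤ meromorphicOrderAt f a → D = 0) ∧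
      ∃ k : ℂ → ℂ, AnalyticAt ℂ k a ∧
        ∀ᶠ z in 𝓝[≠] a, f z = c / (z - a) + deriv D z + k z := by
  by_cases horder : -1 ≤ meromorphicOrderAt f a
  · obtain ⟨h, hh, hfh⟩ := exists_eq_div_sub_of_neg_one_le_order hf horder
    obtain ⟨c, D, k, hD, hD0, hk, heq⟩ := exists_principalPart_of_div_pow 0 hh
    refine ⟨c, D, hD, fun _ => hD0 rfl, k, hk, ?_⟩
    filter_upwards [hfh, self_mem_nhdsWithin] with z hz hza
    rw [hz, heq z hza]
  · obtain ⟨N, hN⟩ := hf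
    have hmul : AnalyticAt ℂ (fun z => (z - a) * ((z - a) ^ N • f z)) a :=
      (analyticAt_id.sub analyticAt_const).mul hN
    obtain ⟨c, D, k, hD, -, hk, heq⟩ := exists_principalPart_of_div_pow N hmul
    refine ⟨c, D, hD, fun h => absurd h horder, k, hk, ?_⟩
    filter_upwards [self_mem_nhdsWithin] with z hz
    rw [← heq z hz, smul_eq_mul, ← mul_assoc, ← pow_succ',
      mul_div_cancel_left₀ _ (pow_ne_zero _ (sub_ne_zero.2 hz))]

end PrincipalPart

/-- Up to the derivative of `E`, the function `G` is the sum of the simple fractions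
`c a / (z - a)`, `a ∈ Z`, on `U \ Z`. -/
def HasPartialFraction (G c E : ℂ → ℂ) (Z : Finset ℂ) (U : Set ℂ) : Prop :=
  ∀ z ∈ U \ Z, HasDerivAt E (G z - ∑ a ∈ Z, c a / (z - a)) z

section PartialFraction

variable {U : Set ℂ} {Z : Finset ℂ} {G c E : ℂ → ℂ} {a : ℂ}

lemma eventually_mem_diff (hU : IsOpen U) (ha : a ∈ U) : ∀ᶠ z in 𝓝[≠] a, z ∈ U \ (Z : Set ℂ) :=
  nhdsNE_of_nhdsNE_sdiff_finite (nhdsWithin_le_nhds (hU.mem_nhds ha)) Z.finite_toSet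

lemma exists_differentiableOn_eqOn (hU : IsOpen U) (hG : DifferentiableOn ℂ G (U \ Z))
    (hremovable : ∀ a ∈ Z, ∃ k : ℂ → ℂ, AnalyticAt ℂ k a ∧ G =ᶠ[𝓝[≠] a] k) :
    ∃ F : ℂ → ℂ, DifferentiableOn ℂ F U ∧ EqOn F G (U \ Z) := by
  classical
  choose! k hk hGk using hremovable
  set F : ℂ → ℂ := fun z => if z ∈ Z then k z z else G z
  have hFG : EqOn F G (U \ Z) := fun z hz => if_neg hz.2
  refine ⟨F, fun z hz => DifferentiableAt.differentiableWithinAt ?_, hFG⟩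
  have hFG_near : F =ᶠ[𝓝[≠] z] G := mem_of_superset (eventually_mem_diff hU hz) hFG
  by_cases hzZ : z ∈ Z
  · exact (hk z hzZ).differentiableAt.congr_of_eventuallyEq <|
      eventuallyEq_nhds_of_eventuallyEq_nhdsNE (hFG_near.trans (hGk z hzZ)) (if_pos hzZ)
  · exact (hG.differentiableAt ((hU.sdiff Z.finite_toSet.isClosed).mem_nhds
      ⟨hz, hzZ⟩)).congr_of_eventuallyEq <|
        eventuallyEq_nhds_of_eventuallyEq_nhdsNE hFG_near (if_neg hzZ)

lemma analyticAt_div_sub_add_deriv {D : ℂ → ℂ} (c : ℂ) (hD : ∀ z ≠ a, DifferentiableAt ℂ D z)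
    {z : ℂ} (hz : z ≠ a) : AnalyticAt ℂ (fun z => c / (z - a) + deriv D z) z := by
  have hDz : AnalyticAt ℂ D z := DifferentiableOn.analyticAt (s := {a}ᶜ)
    (fun y hy => (hD y hy).differentiableWithinAt) (isOpen_compl_singleton.mem_nhds hz)
  exact (analyticAt_const.div (analyticAt_id.sub analyticAt_const) (sub_ne_zero.2 hz)).add hDz.deriv

/-- Subtracting all principal parts leaves a function that is holomorphic on the disc and hence has
a primitive there. -/
theorem exists_hasPartialFraction {z₀ : ℂ} {R : ℝ}
    (hG : DifferentiableOn ℂ G (Metric.ball z₀ R \ Z)) (hmero : ∀ a ∈ Z, MeromorphicAt G a) :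
    ∃ c E : ℂ → ℂ, HasPartialFraction G c E Z (Metric.ball z₀ R) ∧
      ∀ z ∈ Metric.ball z₀ R, (z ∈ Z → -1 ≤ meromorphicOrderAt G z) → DifferentiableAt ℂ E z := by
  classical
  choose! c D hD hD0 k hk hGk using fun a ha => exists_principalPart (hmero a ha)
  set T : ℂ → ℂ → ℂ := fun a z => c a / (z - a) + deriv (D a) z with hT
  have hTa : ∀ a ∈ Z, ∀ z ≠ a, AnalyticAt ℂ (T a) z := fun a ha z hz =>
    analyticAt_div_sub_add_deriv (c a) (hD a ha) hz
  have hregular : DifferentiableOn ℂ (fun z => G z - ∑ a ∈ Z, T a z) (Metric.ball z₀ R \ Z) :=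
    hG.sub <| DifferentiableOn.fun_sum fun a ha z hz =>
      (hTa a ha z (ne_of_mem_of_not_mem ha hz.2).symm).differentiableAt.differentiableWithinAt
  obtain ⟨F, hF, hFG⟩ := exists_differentiableOn_eqOn Metric.isOpen_ball hregular fun a ha => by
    refine ⟨fun z => k a z - ∑ b ∈ Z.erase a, T b z, (hk a ha).sub <|
      Finset.analyticAt_fun_sum _ fun b hb => hTa b (Finset.mem_of_mem_erase hb) a
        (Finset.ne_of_mem_erase hb).symm, ?_⟩
    filter_upwards [hGk a ha] with z hz
    rw [← Finset.add_sum_erase Z _ ha, hz]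
    ring
  obtain ⟨E, hE⟩ := hF.isExactOn_ball
  refine ⟨c, fun z => E z + ∑ a ∈ Z, D a z, fun z hz => ?_, fun z hz hpole => ?_⟩
  · have hDz : ∀ a ∈ Z, HasDerivAt (D a) (deriv (D a) z) z := fun a ha =>
      (hD a ha z (ne_of_mem_of_not_mem ha hz.2).symm).hasDerivAt
    refine ((hE z hz.1).add (HasDerivAt.fun_sum hDz)).congr_deriv ?_
    simp only [hFG hz, hT, Finset.sum_add_distrib]
    ring
  · refine (hE z hz).differentiableAt.add (DifferentiableAt.fun_sum fun a ha => ?_)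
    rcases eq_or_ne z a with rfl | hza
    · rw [hD0 z ha (hpole ha)]
      exact differentiableAt_const _
    · exact hD a ha z hza

lemma HasPartialFraction.differentiableOn (hE : HasPartialFraction G c E Z U) (hU : IsOpen U) :
    DifferentiableOn ℂ G (U \ Z) := by
  have hopen : IsOpen (U \ (Z : Set ℂ)) := hU.sdiff Z.finite_toSet.isClosed
  have hderiv : DifferentiableOn ℂ (deriv E) (U \ Z) :=
    DifferentiableOn.deriv (fun z hz => (hE z hz).differentiableAt.differentiableWithinAt) hopen
  have hsum : DifferentiableOn ℂ (fun z => ∑ a ∈ Z, c a / (z - a)) (U \ Z) :=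
    DifferentiableOn.fun_sum fun a ha => DifferentiableOn.div (by fun_prop) (by fun_prop)
      fun z hz => sub_ne_zero.2 (ne_of_mem_of_not_mem ha hz.2).symm
  refine (hderiv.add hsum).congr fun z hz => ?_
  rw [Pi.add_apply, (hE z hz).deriv, sub_add_cancel]

lemma HasPartialFraction.hasResidue (hE : HasPartialFraction G c E Z U) (hU : IsOpen U)
    (haU : a ∈ U) (haZ : a ∈ Z) : HasResidue G a (c a) := by
  classical
  have hopen : IsOpen (U \ (Z : Set ℂ)) := hU.sdiff Z.finite_toSet.isClosed
  have hnear := eventually_mem_diff (Z := Z) hU haU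
  refine hasResidue_of_sub_analyticAt (K := E) (s := fun z => ∑ b ∈ Z.erase a, c b / (z - b))
    ?_ ?_ ?_
  · exact hnear.mono fun z hz => (hE.differentiableOn hU).differentiableAt (hopen.mem_nhds hz)
  · exact Finset.analyticAt_fun_sum _ fun b hb => analyticAt_const.div
      (analyticAt_id.sub analyticAt_const) (sub_ne_zero.2 (Finset.ne_of_mem_erase hb).symm)
  · filter_upwards [hnear] with z hz
    refine (hE z hz).congr_deriv ?_
    rw [← Finset.add_sum_erase Z _ haZ, sub_add_eq_sub_sub]

end PartialFraction

/-! ### Principal values -/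

/-- The interval `[-T, T]` without the `ε`-neighbourhoods of the points of `P`: the domain of
integration in the definition of the principal value. -/
def excised (P : Set ℝ) (T ε : ℝ) : Set ℝ := {τ | τ ∈ Icc (-T) T ∧ ∀ p ∈ P, ε ≤ |τ - p|}

section PrincipalValue

variable {P : Set ℝ} {T ε : ℝ} {f g : ℝ → ℂ} {u v : ℂ}

lemma isCompact_excised (P : Set ℝ) (T ε : ℝ) : IsCompact (excised P T ε) := by
  have : excised P T ε = Icc (-T) T ∩ ⋂ p ∈ P, {τ | ε ≤ |τ - p|} := by ext τ; simp [excised]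
  rw [this]
  exact isCompact_Icc.inter_right
    (isClosed_biInter fun p _ => isClosed_le continuous_const (by fun_prop))

lemma measurableSet_excised (P : Set ℝ) (T ε : ℝ) : MeasurableSet (excised P T ε) :=
  (isCompact_excised P T ε).measurableSet

lemma excised_subset (hε : 0 < ε) : excised P T ε ⊆ Icc (-T) T \ P := fun τ hτ =>
  ⟨hτ.1, fun hP => hε.not_ge (by simpa using hτ.2 τ hP)⟩

lemma integrableOn_excised (hf : ContinuousOn f (Icc (-T) T \ P)) (hε : 0 < ε) :
    IntegrableOn f (excised P T ε) :=
  (hf.mono (excised_subset hε)).integrableOn_compact (isCompact_excised P T ε)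

lemma HasPVIntegralUpTo.congr (h : HasPVIntegralUpTo f P T v) (hfg : EqOn g f (Icc (-T) T \ P)) :
    HasPVIntegralUpTo g P T v := by
  refine Tendsto.congr' ?_ h
  filter_upwards [self_mem_nhdsWithin] with ε hε
  exact setIntegral_congr_fun (measurableSet_excised P T ε) fun τ hτ =>
    (hfg (excised_subset hε hτ)).symm

lemma HasPVIntegralUpTo.const_mul (h : HasPVIntegralUpTo f P T v) (c : ℂ) :
    HasPVIntegralUpTo (fun τ => c * f τ) P T (c * v) := by
  simpa only [HasPVIntegralUpTo, integral_const_mul] using Tendsto.const_mul c h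

lemma HasPVIntegralUpTo.add (hf : HasPVIntegralUpTo f P T u) (hg : HasPVIntegralUpTo g P T v)
    (hfc : ContinuousOn f (Icc (-T) T \ P)) (hgc : ContinuousOn g (Icc (-T) T \ P)) :
    HasPVIntegralUpTo (fun τ => f τ + g τ) P T (u + v) := by
  refine (Tendsto.add hf hg).congr' ?_
  filter_upwards [self_mem_nhdsWithin] with ε hε
  exact (integral_add (integrableOn_excised hfc hε) (integrableOn_excised hgc hε)).symm

lemma eventually_mem_excised (hP : IsClosed P) {τ : ℝ} (hτ : τ ∈ Icc (-T) T \ P) :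
    ∀ᶠ ε in 𝓝[>] (0 : ℝ), τ ∈ excised P T ε := by
  obtain ⟨δ, hδ, hball⟩ := Metric.isOpen_iff.1 hP.isOpen_compl τ hτ.2
  filter_upwards [Ioo_mem_nhdsGT hδ] with ε hε
  refine ⟨hτ.1, fun p hp => ?_⟩
  by_contra! hlt
  exact hball (by rw [Metric.mem_ball, dist_comm, Real.dist_eq]; exact hlt.trans hε.2) hp

lemma ae_notMem_of_compl_mem_codiscrete (hP : Pᶜ ∈ codiscrete ℝ) : ∀ᵐ τ : ℝ, τ ∉ P := by
  have := ae_restrict_le_codiscreteWithin (μ := volume) MeasurableSet.univ hP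
  rwa [Measure.restrict_univ] at this

lemma tendsto_setIntegral_inter_excised (hP : Pᶜ ∈ codiscrete ℝ) {K : Set ℝ}
    (hK : MeasurableSet K) (hKT : K ⊆ Icc (-T) T) (hf : IntegrableOn f K) :
    Tendsto (fun ε => ∫ τ in K ∩ excised P T ε, f τ) (𝓝[>] 0) (𝓝 (∫ τ in K, f τ)) := by
  simp only [← setIntegral_indicator (measurableSet_excised P T _)]
  refine tendsto_integral_filter_of_dominated_convergence (fun τ => ‖f τ‖)
    (Eventually.of_forall fun ε => hf.aestronglyMeasurable.indicator (measurableSet_excised P T ε))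
    (Eventually.of_forall fun ε => Eventually.of_forall fun τ => norm_indicator_le_norm_self _ _)
    hf.norm ?_
  filter_upwards [ae_restrict_mem hK, ae_restrict_of_ae (ae_notMem_of_compl_mem_codiscrete hP)]
    with τ hτK hτP
  refine tendsto_const_nhds.congr' ?_
  filter_upwards [eventually_mem_excised (compl_mem_codiscrete_iff.1 hP).1 ⟨hKT hτK, hτP⟩]
    with ε hε
  rw [indicator_of_mem hε]

lemma hasPVIntegralUpTo_of_continuousOn (hP : Pᶜ ∈ codiscrete ℝ) (hT : 0 ≤ T)
    (hf : ContinuousOn f (Icc (-T) T)) : HasPVIntegralUpTo f P T (∫ τ in (-T)..T, f τ) := by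
  rw [intervalIntegral.integral_of_le (by linarith), ← integral_Icc_eq_integral_Ioc]
  refine (tendsto_setIntegral_inter_excised hP measurableSet_Icc subset_rfl
    (hf.integrableOn_compact isCompact_Icc)).congr fun ε => ?_
  rw [inter_eq_self_of_subset_right fun τ hτ => hτ.1]
  rfl

lemma setIntegral_excised_singleton {p : ℝ} (hε : 0 < ε) (hp : ε < p + T) (hp' : ε < T - p)
    (hf : ContinuousOn f (Icc (-T) T \ {p})) :
    ∫ τ in excised {p} T ε, f τ = (∫ τ in (-T)..(p - ε), f τ) + ∫ τ in (p + ε)..T, f τ := by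
  have hunion : excised {p} T ε = Icc (-T) (p - ε) ∪ Icc (p + ε) T := by
    ext τ
    simp only [excised, mem_singleton_iff, forall_eq, mem_ofPred_eq, mem_union, mem_Icc, le_abs]
    grind
  have hint := integrableOn_excised hf hε
  rw [hunion, integrableOn_union] at hint
  rw [hunion, setIntegral_union ?_ measurableSet_Icc hint.1 hint.2,
    intervalIntegral.integral_of_le (by linarith), intervalIntegral.integral_of_le (by linarith),
    integral_Icc_eq_integral_Ioc, integral_Icc_eq_integral_Ioc]
  exact disjoint_left.2 fun τ hl hr => by linarith [hl.2, hr.1]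

lemma excised_eq_union {p δ : ℝ} (hp : p ∈ P) (hδ : ∀ q ∈ P, q ≠ p → 2 * δ ≤ |q - p|)
    (hε : ε ≤ δ) :
    excised P T ε = (excised {p} T ε \ excised {p} T δ) ∪ (excised {p} T δ ∩ excised P T ε) := by
  ext τ
  simp only [excised, mem_singleton_iff, forall_eq, mem_ofPred_eq, mem_union, Set.mem_sdiff,
    mem_inter_iff]
  refine ⟨fun h => ?_, ?_⟩
  · by_cases hτ : δ ≤ |τ - p|
    · exact Or.inr ⟨⟨h.1, hτ⟩, h⟩
    · exact Or.inl ⟨⟨h.1, h.2 p hp⟩, fun h' => hτ h'.2⟩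
  · rintro (⟨⟨hT, hετ⟩, hδτ⟩ | h)
    · refine ⟨hT, fun q hq => ?_⟩
      rcases eq_or_ne q p with rfl | hqp
      · exact hετ
      · have := abs_sub_le q τ p
        rw [abs_sub_comm q τ] at this
        linarith [hδ q hq hqp, not_le.1 fun h => hδτ ⟨hT, h⟩]
    · exact h.2

/-- Near `p` only `p` itself is excised, and away from `p` the function is integrable, so that the
other excisions do not matter in the limit. -/
lemma hasPVIntegralUpTo_of_singularity (hP : Pᶜ ∈ codiscrete ℝ) {p : ℝ} (hpP : p ∈ P)
    (hp : p ∈ Ioo (-T) T) (hf : ContinuousOn f (Icc (-T) T \ {p}))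
    (hv : Tendsto (fun ε => (∫ τ in (-T)..(p - ε), f τ) + ∫ τ in (p + ε)..T, f τ)
      (𝓝[>] 0) (𝓝 v)) : HasPVIntegralUpTo f P T v := by
  obtain ⟨r, hr, hball⟩ := Metric.mem_nhdsWithin_iff.1
    (disjoint_principal_right.1 (mem_codiscrete.1 hP p))
  obtain ⟨δ, hδ, hiso⟩ : ∃ δ > 0, ∀ q ∈ P, q ≠ p → 2 * δ ≤ |q - p| := by
    refine ⟨r / 2, half_pos hr, fun q hq hqp => ?_⟩
    by_contra! hlt
    exact hball ⟨by rw [Metric.mem_ball, Real.dist_eq]; linarith, hqp⟩ (not_not.2 hq)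
  set K := excised {p} T δ
  have hfar := tendsto_setIntegral_inter_excised hP (measurableSet_excised {p} T δ)
    (fun τ hτ => hτ.1) (integrableOn_excised hf hδ)
  have htotal := (hv.sub_const (∫ τ in K, f τ)).add hfar
  rw [sub_add_cancel] at htotal
  refine htotal.congr' ?_
  filter_upwards [Ioo_mem_nhdsGT hδ, Ioo_mem_nhdsGT (show 0 < p + T by linarith [hp.1]),
    Ioo_mem_nhdsGT (sub_pos.2 hp.2)] with ε hε hεl hεr
  have hnear := integrableOn_excised hf hε.1
  have hKε : K ⊆ excised {p} T ε := fun τ hτ => ⟨hτ.1, fun q hq => hε.2.le.trans (hτ.2 q hq)⟩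
  rw [← setIntegral_excised_singleton hε.1 hεl.2 hεr.2 hf,
    ← setIntegral_sdiff (measurableSet_excised _ _ _) hnear hKε,
    ← setIntegral_union (disjoint_sdiff_left.mono_right inter_subset_left)
      ((measurableSet_excised _ _ _).inter (measurableSet_excised _ _ _))
      (hnear.mono_set sdiff_subset)
      (hnear.mono_set (inter_subset_left.trans hKε)), ← excised_eq_union hpP hiso hε.2.le]
  rfl

end PrincipalValue

/-! ### The closed path in the plane of `w = e^{iθ}` -/

section ExpPath

variable {u : ℝ → ℂ}

lemma contDiff_exp_I_mul (hu : ContDiff ℝ 1 u) : ContDiff ℝ 1 fun τ => cexp (I * u τ) :=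
  (contDiff_const.mul hu).cexp

lemma deriv_exp_I_mul (hu : ContDiff ℝ 1 u) (τ : ℝ) :
    deriv (fun τ => cexp (I * u τ)) τ = I * cexp (I * u τ) * deriv u τ := by
  rw [((((hu.differentiable one_ne_zero) τ).hasDerivAt.const_mul I).cexp).deriv]
  ring

lemma lineIntegral_exp_I_mul (hu : ContDiff ℝ 1 u) (φ : ℂ → ℂ) (s t : ℝ) :
    lineIntegral φ (fun τ => cexp (I * u τ)) s t =
      I * lineIntegral (fun θ => cexp (I * θ) * φ (cexp (I * θ))) u s t := by
  rw [← lineIntegral_const_mul]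
  refine intervalIntegral.integral_congr fun τ _ => ?_
  simp only [deriv_exp_I_mul hu]
  ring

end ExpPath

lemma arg_exp_I_mul {θ : ℂ} (h : θ.re ∈ Ioc (-π) π) : arg (cexp (I * θ)) = θ.re := by
  rw [Complex.arg_exp, I_mul_im]
  exact (toIocMod_eq_self Real.two_pi_pos).2 ⟨h.1, by linarith [h.2]⟩

lemma log_norm_exp_I_mul (θ : ℂ) : Real.log ‖cexp (I * θ)‖ = -θ.im := by
  rw [norm_exp, Real.log_exp, I_mul_re]

lemma thetaZero_re (x ζ : ℂ) : (thetaZero x ζ).re = arg (x * ζ) := by simp [thetaZero]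

lemma thetaZero_im (x ζ : ℂ) : (thetaZero x ζ).im = -Real.log ‖x * ζ‖ := by simp [thetaZero]

lemma exp_thetaZero {x ζ : ℂ} (h : x * ζ ≠ 0) : cexp (I * thetaZero x ζ) = x * ζ := by
  have hlog : I * thetaZero x ζ = log (x * ζ) := by
    rw [log, thetaZero]
    linear_combination (-(Real.log ‖x * ζ‖ : ℂ)) * I_mul_I
  rw [hlog, exp_log h]

lemma eq_exp_I_mul {a θ : ℂ} (ha : a ≠ 0) (hre : arg a = θ.re) (him : Real.log ‖a‖ = -θ.im) :
    a = cexp (I * θ) := by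
  have hθ : thetaZero 1 a = θ := by
    apply Complex.ext
    · rw [thetaZero_re, one_mul, hre]
    · rw [thetaZero_im, one_mul, him, neg_neg]
  rw [← hθ, exp_thetaZero (by rwa [one_mul]), one_mul]

/-- The image of the steepest-descent curve in the `w`-plane. -/
noncomputable def curveW (τ : ℝ) : ℂ := cexp (I * theta τ)

/-- The image in the `w`-plane of the horizontal line through `θ(T)`: a circle about `0`,
parametrized by the real part of `θ`. -/
noncomputable def arcW (T X : ℝ) : ℂ := cexp (I * (X + (theta T).im * I))

/-- The two circular arcs that join `w(-T)` and `w(T)` to the negative real axis, the images of the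
segments closing the contour in the `θ`-plane. -/
def arcs (T : ℝ) : Set ℂ := arcW T '' (Icc (-π) (theta (-T)).re ∪ Icc (theta T).re π)

/-- The closed path in the `w`-plane: the curve for `|τ| ≤ T`, followed by the arcs. -/
def closedPath (T : ℝ) : Set ℂ := curveW '' Icc (-T) T ∪ arcs T

/-- The logarithm of the radius of the closed path in the direction `β`: the path is star-shaped
about `0`. -/
noncomputable def pathLogRadius (T β : ℝ) : ℝ :=
  if |β| < (theta T).re then -height β else -(theta T).im

section ClosedPath

variable {T : ℝ} {a w : ℂ}

lemma contDiff_curveW : ContDiff ℝ 1 curveW :=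
  contDiff_exp_I_mul (contDiff_theta.of_le (by simp))

lemma contDiff_arcW (T : ℝ) : ContDiff ℝ 1 (arcW T) := contDiff_exp_I_mul (contDiff_horizontal _)

lemma arg_curveW (τ : ℝ) : arg (curveW τ) = (theta τ).re :=
  arg_exp_I_mul (Ioo_subset_Ioc_self (theta_re_mem τ))

lemma log_norm_curveW (τ : ℝ) : Real.log ‖curveW τ‖ = -(theta τ).im := log_norm_exp_I_mul _

lemma curveW_ne_zero (τ : ℝ) : curveW τ ≠ 0 := exp_ne_zero _

lemma curveW_injective : Function.Injective curveW := fun s t h => by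
  apply theta_injective
  have hre := congrArg arg h
  rw [arg_curveW, arg_curveW] at hre
  rw [theta_eq_graphPt, hre, ← theta_eq_graphPt]

lemma arcW_theta_re (T : ℝ) : arcW T (theta T).re = curveW T := by
  rw [arcW, curveW, re_add_im]

lemma arcW_theta_neg_re (T : ℝ) : arcW T (theta (-T)).re = curveW (-T) := by
  rw [arcW, curveW, ← theta_neg_im T, re_add_im]

lemma arcW_neg_pi (T : ℝ) : arcW T (-π) = arcW T π := by
  rw [arcW, arcW, Complex.exp_eq_exp_iff_exists_int]
  exact ⟨-1, by push_cast; ring⟩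

lemma image_curveW_subset (hT : 0 < T) : curveW '' uIcc (-T) T ⊆ closedPath T := by
  rw [uIcc_of_le (by linarith)]
  exact subset_union_left

lemma image_arcW_left_subset : arcW T '' uIcc (-π) (theta (-T)).re ⊆ arcs T := by
  rw [uIcc_of_le (theta_re_mem _).1.le]
  exact image_mono subset_union_left

lemma image_arcW_right_subset : arcW T '' uIcc (theta T).re π ⊆ arcs T := by
  rw [uIcc_of_le (theta_re_mem _).2.le]
  exact image_mono subset_union_right

lemma arcs_subset_closedPath : arcs T ⊆ closedPath T := subset_union_right

lemma mem_image_curveW_iff (hT : 0 < T) :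
    a ∈ curveW '' Ioo (-T) T ↔
      a ≠ 0 ∧ |arg a| < (theta T).re ∧ Real.log ‖a‖ = -height (arg a) := by
  have hmem : ∀ p, p ∈ Ioo (-T) T ↔ |(theta p).re| < (theta T).re := fun p => by
    rw [← abs_of_pos (theta_re_pos hT), abs_theta_re_lt_iff, abs_of_pos hT, abs_lt, mem_Ioo]
  constructor
  · rintro ⟨p, hp, rfl⟩
    rw [arg_curveW, log_norm_curveW, theta_im]
    exact ⟨curveW_ne_zero p, (hmem p).1 hp, rfl⟩
  · rintro ⟨ha, harg, hlog⟩
    obtain ⟨p, hp⟩ := exists_theta_eq (abs_lt.1 (harg.trans (theta_re_mem T).2))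
    refine ⟨p, (hmem p).2 (by rwa [hp, graphPt_re]), (eq_exp_I_mul ha ?_ ?_).symm⟩
    · rw [hp, graphPt_re]
    · rw [hp, graphPt_im, hlog]

lemma mem_arcs_iff : a ∈ arcs T ↔
    a ≠ 0 ∧ (theta T).re ≤ |arg a| ∧ Real.log ‖a‖ = -(theta T).im := by
  have hline : ∀ X : ℝ, ((X : ℂ) + (theta T).im * I).re = X ∧
      ((X : ℂ) + (theta T).im * I).im = (theta T).im := fun X => by simp
  have harg : ∀ X ∈ Ioc (-π) π, arg (arcW T X) = X := fun X hX => by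
    rw [arcW, arg_exp_I_mul (by rwa [(hline X).1]), (hline X).1]
  rw [arcs, theta_neg_re]
  constructor
  · rintro ⟨X, hX, rfl⟩
    refine ⟨exp_ne_zero _, ?_, by rw [arcW, log_norm_exp_I_mul, (hline X).2]⟩
    rcases hX with ⟨hl, hr⟩ | ⟨hl, hr⟩
    · rcases hl.eq_or_lt with rfl | hl
      · rw [arcW_neg_pi, harg π ⟨by linarith [Real.pi_pos], le_rfl⟩]
        exact (theta_re_mem T).2.le.trans (le_abs_self π)
      · rw [harg X ⟨hl, hr.trans (by linarith [(theta_re_mem T).1])⟩]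
        exact le_abs.2 (Or.inr (by linarith))
    · rw [harg X ⟨(theta_re_mem T).1.trans_le hl, hr⟩]
      exact hl.trans (le_abs_self X)
  · rintro ⟨ha, habs, hlog⟩
    refine ⟨arg a, ?_, (eq_exp_I_mul ha (hline _).1.symm (by rw [hlog, (hline _).2])).symm⟩
    rcases le_abs.1 habs with h | h
    · exact Or.inr ⟨h, arg_le_pi a⟩
    · exact Or.inl ⟨(neg_pi_lt_arg a).le, by linarith⟩

lemma closedPath_eq_union (hT : 0 < T) : closedPath T = curveW '' Ioo (-T) T ∪ arcs T := by
  refine subset_antisymm (union_subset ?_ subset_union_right)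
    (union_subset_union_left _ (image_mono Ioo_subset_Icc_self))
  rintro _ ⟨τ, hτ, rfl⟩
  rcases hτ.1.eq_or_lt with rfl | hl
  · exact Or.inr ⟨_, Or.inl ⟨(theta_re_mem _).1.le, le_rfl⟩, arcW_theta_neg_re T⟩
  rcases hτ.2.eq_or_lt with rfl | hr
  · exact Or.inr ⟨_, Or.inr ⟨le_rfl, (theta_re_mem _).2.le⟩, arcW_theta_re τ⟩
  · exact Or.inl ⟨τ, ⟨hl, hr⟩, rfl⟩

lemma mem_closedPath_iff (hT : 0 < T) :
    a ∈ closedPath T ↔ a ≠ 0 ∧ Real.log ‖a‖ = pathLogRadius T (arg a) := by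
  rw [closedPath_eq_union hT, mem_union, mem_image_curveW_iff hT, mem_arcs_iff, pathLogRadius]
  split_ifs with h
  · simp [h, h.not_ge]
  · simp [h, not_lt.1 h]

lemma pathLogRadius_lt (h : |arg a| < (theta T).re) :
    pathLogRadius T (arg a) < -(theta T).im := by
  rw [pathLogRadius, if_pos h, theta_im, neg_lt_neg_iff]
  exact height_lt_height (theta_re_mem T) (h.trans_le (le_abs_self _))

/-! ### Winding numbers -/

/-- The integral of `φ(w) dw` along the two arcs. -/
noncomputable def arcInt (φ : ℂ → ℂ) (T : ℝ) : ℂ :=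
  lineIntegral φ (arcW T) (-π) (theta (-T)).re + lineIntegral φ (arcW T) (theta T).re π

/-- The contour integral of `φ(w) dw` along the closed path. -/
noncomputable def closedInt (φ : ℂ → ℂ) (T : ℝ) : ℂ :=
  lineIntegral φ curveW (-T) T + arcInt φ T

variable {φ ψ L : ℂ → ℂ}

lemma arcInt_congr (h : EqOn φ ψ (arcs T)) : arcInt φ T = arcInt ψ T :=
  congrArg₂ (· + ·) (lineIntegral_congr (h.mono image_arcW_left_subset))
    (lineIntegral_congr (h.mono image_arcW_right_subset))

lemma arcInt_const_mul (c : ℂ) : arcInt (fun w => c * φ w) T = c * arcInt φ T := by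
  simp only [arcInt, lineIntegral_const_mul, mul_add]

lemma arcInt_add (hφ : ContinuousOn φ (arcs T)) (hψ : ContinuousOn ψ (arcs T)) :
    arcInt (fun w => φ w + ψ w) T = arcInt φ T + arcInt ψ T := by
  rw [arcInt, lineIntegral_add (contDiff_arcW T) (hφ.mono image_arcW_left_subset)
      (hψ.mono image_arcW_left_subset),
    lineIntegral_add (contDiff_arcW T) (hφ.mono image_arcW_right_subset)
      (hψ.mono image_arcW_right_subset), arcInt, arcInt]
  ring

lemma closedInt_add (hT : 0 < T) (hφ : ContinuousOn φ (closedPath T))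
    (hψ : ContinuousOn ψ (closedPath T)) :
    closedInt (fun w => φ w + ψ w) T = closedInt φ T + closedInt ψ T := by
  rw [closedInt, lineIntegral_add contDiff_curveW (hφ.mono (image_curveW_subset hT))
    (hψ.mono (image_curveW_subset hT)), arcInt_add (hφ.mono arcs_subset_closedPath)
    (hψ.mono arcs_subset_closedPath), closedInt, closedInt]
  ring

lemma arcInt_of_hasDerivAt (hL : ∀ w ∈ arcs T, HasDerivAt L (φ w) w)
    (hφ : ContinuousOn φ (arcs T)) : arcInt φ T = L (curveW (-T)) - L (curveW T) := by
  rw [arcInt, lineIntegral_of_hasDerivAt (contDiff_arcW T)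
      (fun w hw => hL w (image_arcW_left_subset hw)) (hφ.mono image_arcW_left_subset),
    lineIntegral_of_hasDerivAt (contDiff_arcW T)
      (fun w hw => hL w (image_arcW_right_subset hw)) (hφ.mono image_arcW_right_subset),
    arcW_theta_re, arcW_theta_neg_re, arcW_neg_pi]
  ring

lemma closedInt_of_hasDerivAt (hT : 0 < T) (hL : ∀ w ∈ closedPath T, HasDerivAt L (φ w) w)
    (hφ : ContinuousOn φ (closedPath T)) : closedInt φ T = 0 := by
  rw [closedInt, lineIntegral_of_hasDerivAt contDiff_curveW
      (fun w hw => hL w (image_curveW_subset hT hw)) (hφ.mono (image_curveW_subset hT)),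
    arcInt_of_hasDerivAt (fun w hw => hL w (arcs_subset_closedPath hw))
      (hφ.mono arcs_subset_closedPath)]
  ring

lemma arcInt_eq_integral (φ : ℂ → ℂ) (T : ℝ) :
    arcInt φ T = I *
      ((∫ X in (-π)..(theta (-T)).re, arcW T X * φ (arcW T X)) +
        ∫ X in (theta T).re..π, arcW T X * φ (arcW T X)) := by
  have hline : ∀ s t, lineIntegral φ (arcW T) s t = I * ∫ X in s..t, arcW T X * φ (arcW T X) :=
    fun s t => (lineIntegral_exp_I_mul (contDiff_horizontal _) φ s t).trans
      (congrArg (I * ·) (lineIntegral_horizontal _ _ _ _))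
  rw [arcInt, hline, hline, mul_add]

lemma closedInt_inv (T : ℝ) : closedInt (fun w => w⁻¹) T = 2 * π * I := by
  have hcurve : lineIntegral (fun w => w⁻¹) curveW (-T) T = I * (theta T - theta (-T)) := by
    refine (lineIntegral_exp_I_mul (contDiff_theta.of_le (by simp)) _ _ _).trans ?_
    rw [lineIntegral_of_hasDerivAt (L := id) (contDiff_theta.of_le (by simp))]
    · rfl
    · intro θ _
      simpa only [mul_inv_cancel₀ (exp_ne_zero _)] using hasDerivAt_id θ
    · simpa only [mul_inv_cancel₀ (exp_ne_zero _)] using continuousOn_const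
  have hdiff : theta T - theta (-T) = 2 * (theta T).re := by
    apply Complex.ext <;> simp
    ring
  rw [closedInt, hcurve, hdiff, arcInt_eq_integral]
  simp only [arcW, mul_inv_cancel₀ (exp_ne_zero _), intervalIntegral.integral_const, theta_neg_re,
    real_smul]
  push_cast
  ring

lemma neg_inv_mul_sub_mem_slitPlane (hw : w ≠ 0) (ha : a ≠ 0)
    (h : arg w = arg a → Real.log ‖w‖ < Real.log ‖a‖) : -a⁻¹ * (w - a) ∈ slitPlane := by
  have hsub : -a⁻¹ * (w - a) = 1 - w / a := by field_simp; ring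
  rw [hsub, mem_slitPlane_iff]
  by_contra! hcon
  obtain ⟨r, hr⟩ : ∃ r : ℝ, w / a = r := ⟨(w / a).re, Complex.ext rfl (by simpa using hcon.2)⟩
  have hr1 : 1 ≤ r := by simpa [hr] using hcon.1
  obtain rfl : w = r * a := (div_eq_iff ha).1 hr
  have hlt := h (arg_real_mul _ (by linarith))
  rw [norm_mul, norm_real, Real.norm_of_nonneg (by linarith),
    Real.log_mul (by linarith) (norm_ne_zero_iff.2 ha)] at hlt
  linarith [Real.log_nonneg hr1]

/-- The path avoids the ray from `a` to infinity. -/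
lemma closedInt_inv_sub_of_lt (hT : 0 < T) (ha : a ≠ 0)
    (h : pathLogRadius T (arg a) < Real.log ‖a‖) : closedInt (fun w => (w - a)⁻¹) T = 0 := by
  refine closedInt_of_hasDerivAt (L := fun w => log (-a⁻¹ * (w - a))) hT (fun w hw => ?_)
    (continuousOn_inv_sub fun hmem => h.ne' ((mem_closedPath_iff hT).1 hmem).2)
  obtain ⟨hw0, hwlog⟩ := (mem_closedPath_iff hT).1 hw
  exact hasDerivAt_log_mul_sub
    (neg_inv_mul_sub_mem_slitPlane hw0 ha fun harg => by rwa [hwlog, harg])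

/-- On the path `log (1 - a / w)` is a primitive of `(w - a)⁻¹ - w⁻¹`. -/
lemma closedInt_inv_sub_of_gt (hT : 0 < T) (h : a ≠ 0 → Real.log ‖a‖ < pathLogRadius T (arg a)) :
    closedInt (fun w => (w - a)⁻¹) T = 2 * π * I := by
  rcases eq_or_ne a 0 with rfl | ha
  · simpa using closedInt_inv T
  have h0 : (0 : ℂ) ∉ closedPath T := fun hmem => ((mem_closedPath_iff hT).1 hmem).1 rfl
  have hinv := continuousOn_inv_sub h0
  simp only [sub_zero] at hinv
  have hsub := continuousOn_inv_sub
    fun hmem : a ∈ closedPath T => (h ha).ne ((mem_closedPath_iff hT).1 hmem).2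
  have hzero : closedInt (fun w => (w - a)⁻¹ - w⁻¹) T = 0 := by
    refine closedInt_of_hasDerivAt (L := fun w => log (-w⁻¹ * (a - w))) hT (fun w hw => ?_)
      (hsub.sub hinv)
    obtain ⟨hw0, hwlog⟩ := (mem_closedPath_iff hT).1 hw
    have hslit := neg_inv_mul_sub_mem_slitPlane ha hw0 fun harg => by
      rw [hwlog, ← harg]
      exact h ha
    have haw : a - w ≠ 0 := right_ne_zero_of_mul (slitPlane_ne_zero hslit)
    have hwa : w - a ≠ 0 := by rwa [← neg_ne_zero, neg_sub]
    refine (((hasDerivAt_inv hw0).neg.mul ((hasDerivAt_id w).const_sub a)).clog hslit).congr_deriv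
      ?_
    simp only [Pi.mul_apply, Pi.neg_apply, id]
    field_simp
    ring
  have hsum := closedInt_add (φ := fun w => (w - a)⁻¹ - w⁻¹) hT (hsub.sub hinv) hinv
  simpa only [sub_add_cancel, hzero, closedInt_inv, zero_add] using hsum

lemma tendsto_log_sub_log {u : ℝ → ℂ} {p : ℝ} {d : ℂ} (hu0 : u p = 0) (hu : HasDerivAt u (-d) p)
    (hd : 0 < d.im) :
    Tendsto (fun ε => log (u (p - ε)) - log (u (p + ε))) (𝓝[>] 0) (𝓝 (π * I)) := by
  have hright : Tendsto (fun ε : ℝ => ((ε⁻¹ : ℝ) : ℂ) * u (p + ε)) (𝓝[>] 0) (𝓝 (-d)) := by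
    simpa [hu0] using hu.tendsto_slope_zero_right
  have hleft : Tendsto (fun ε : ℝ => ((ε⁻¹ : ℝ) : ℂ) * u (p - ε)) (𝓝[>] 0) (𝓝 d) := by
    have hneg : Tendsto (fun ε : ℝ => -ε) (𝓝[>] 0) (𝓝[<] 0) := by
      simpa using tendsto_neg_nhdsGT (a := (0 : ℝ))
    simpa [hu0, Function.comp_def, ← sub_eq_add_neg, inv_neg]
      using (hu.tendsto_slope_zero_left.comp hneg).neg
  have hd0 : d ≠ 0 := fun h => by simp [h] at hd
  have hlog := (hleft.clog (Or.inr hd.ne')).sub (hright.clog (Or.inr (by simpa using hd.ne')))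
  rw [log_sub_log_neg hd] at hlog
  refine hlog.congr' ?_
  filter_upwards [self_mem_nhdsWithin, hleft.eventually_ne hd0,
    hright.eventually_ne (neg_ne_zero.2 hd0)] with ε hε hl hr
  rw [log_ofReal_mul (inv_pos.2 hε) (right_ne_zero_of_mul hl),
    log_ofReal_mul (inv_pos.2 hε) (right_ne_zero_of_mul hr)]
  ring

/-- The primitive `log (1 - w / w(p))` jumps by `πi` when `w` passes through `w(p)`. -/
lemma tendsto_closedInt_inv_sub_curveW {p : ℝ} (hp : p ∈ Ioo (-T) T) :
    Tendsto (fun ε => lineIntegral (fun w => (w - curveW p)⁻¹) curveW (-T) (p - ε)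
        + lineIntegral (fun w => (w - curveW p)⁻¹) curveW (p + ε) T) (𝓝[>] 0)
      (𝓝 (π * I - arcInt (fun w => (w - curveW p)⁻¹) T)) := by
  have hT : 0 < T := by linarith [hp.1, hp.2]
  set a := curveW p with ha
  have ha0 : a ≠ 0 := curveW_ne_zero p
  have hcurve : ∀ τ, τ ≠ p → -a⁻¹ * (curveW τ - a) ∈ slitPlane := fun τ hτ =>
    neg_inv_mul_sub_mem_slitPlane (curveW_ne_zero τ) ha0 fun harg => by
      rw [ha, arg_curveW, arg_curveW] at harg
      exact absurd (theta_injective (by rw [theta_eq_graphPt, harg, ← theta_eq_graphPt])) hτ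
  have ha_arc := ((mem_image_curveW_iff hT).1 ⟨p, hp, rfl⟩).2.1
  have harc : ∀ w ∈ arcs T, -a⁻¹ * (w - a) ∈ slitPlane := fun w hw => by
    obtain ⟨hw0, hw, -⟩ := mem_arcs_iff.1 hw
    exact neg_inv_mul_sub_mem_slitPlane hw0 ha0 fun harg => absurd ha_arc (harg ▸ hw.not_gt)
  have hA := arcInt_of_hasDerivAt (fun w hw => hasDerivAt_log_mul_sub (harc w hw))
    (continuousOn_inv_sub fun hmem => (mem_arcs_iff.1 hmem).2.1.not_gt ha_arc)
  have hderiv : HasDerivAt (fun τ => -a⁻¹ * (curveW τ - a)) (-(I * deriv theta p)) p := by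
    refine (((contDiff_curveW.differentiable one_ne_zero p).hasDerivAt.sub_const a).const_mul
      (-a⁻¹)).congr_deriv ?_
    rw [show deriv curveW p = I * a * deriv theta p from
      deriv_exp_I_mul (contDiff_theta.of_le (by simp)) p]
    field_simp
  have hjump := tendsto_log_sub_log (by simp [ha]) hderiv (by simpa using deriv_theta_re_pos p)
  refine (hjump.sub_const (arcInt (fun w => (w - a)⁻¹) T)).congr' ?_
  filter_upwards [Ioo_mem_nhdsGT (show 0 < p + T by linarith [hp.1]),
    Ioo_mem_nhdsGT (sub_pos.2 hp.2)] with ε hεl hεr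
  have hε := hεl.1
  rw [hA, lineIntegral_inv_sub (-a⁻¹) contDiff_curveW (s := -T),
    lineIntegral_inv_sub (-a⁻¹) contDiff_curveW (s := p + ε)]
  · ring
  · rw [uIcc_of_le (by linarith [hεr.2])]
    exact fun τ hτ => hcurve τ (by linarith [hτ.1])
  · rw [uIcc_of_le (by linarith [hεl.2])]
    exact fun τ hτ => hcurve τ (by linarith [hτ.2])

end ClosedPath

/-! ### The principal value along the closed path -/

/-- The weight of a point `a` of the `w`-plane with respect to the closed path: the principal value
of its winding number, that is `1`, `1/2` or `0` for a point inside, on or outside the path. -/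
noncomputable def pathWeight (T : ℝ) (a : ℂ) : ℝ :=
  if a = 0 then 1 else stepTheta (pathLogRadius T (arg a) - Real.log ‖a‖)

/-- `PV ∮ φ(w) dw = v` along the closed path, with symmetric excisions at the parameters of the
points of `Q` on the curve. The arcs carry an ordinary integral. -/
def HasPVClosedIntegral (φ : ℂ → ℂ) (Q : Set ℂ) (T : ℝ) (v : ℂ) : Prop :=
  HasPVIntegralUpTo (fun τ => φ (curveW τ) * deriv curveW τ) (curveW ⁻¹' Q) T (v - arcInt φ T)

section PVClosedIntegral

variable {T : ℝ} {Q : Set ℂ} {φ ψ : ℂ → ℂ} {u v a : ℂ}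

lemma psi_eq (θ : ℂ) : psi θ = θ.im - height θ.re := by
  rw [psi, height]
  split_ifs with h
  · simp [h]
  · rw [Real.sinc_of_ne_zero h]

lemma stepTheta_of_pos {t : ℝ} (h : 0 < t) : stepTheta t = 1 := if_pos h

lemma stepTheta_of_neg {t : ℝ} (h : t < 0) : stepTheta t = 0 := by
  rw [stepTheta, if_neg h.not_gt, if_neg h.ne]

lemma stepTheta_zero : stepTheta 0 = 1 / 2 := by simp [stepTheta]

lemma weight_thetaZero {x ζ : ℂ} (hT : 0 < T) (h0 : x * ζ ≠ 0)
    (h : (theta T).im < (thetaZero x ζ).im) : weight (thetaZero x ζ) =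
      pathWeight T (x * ζ) := by
  rw [weight, pathWeight, if_neg h0, psi_eq]
  rw [thetaZero_im] at h
  rw [thetaZero_re, thetaZero_im, pathLogRadius]
  by_cases harg : |arg (x * ζ)| < (theta T).re
  · have hπ : arg (x * ζ) ≠ π := ((le_abs_self _).trans_lt (harg.trans (theta_re_mem T).2)).ne
    rw [if_neg hπ, if_pos harg]
    congr 1
    ring
  rw [if_neg harg, stepTheta_of_pos (t := _ - Real.log _) (by linarith)]
  split_ifs with hπ
  · rfl
  have hle : height (arg (x * ζ)) ≤ (theta T).im := by
    rw [theta_im]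
    refine height_le_height ⟨neg_pi_lt_arg _, (arg_le_pi _).lt_of_ne hπ⟩ ?_
    rwa [abs_of_pos (theta_re_pos hT), ← not_lt]
  exact stepTheta_of_pos (by linarith)

lemma pathWeight_eq_zero (ha : a ≠ 0) (harc : a ∉ arcs T) (h : -(theta T).im ≤ Real.log ‖a‖) :
    pathWeight T a = 0 := by
  rw [pathWeight, if_neg ha]
  refine stepTheta_of_neg (sub_neg.2 ?_)
  by_cases harg : |arg a| < (theta T).re
  · exact (pathLogRadius_lt harg).trans_le h
  · rw [pathLogRadius, if_neg harg]
    exact h.lt_of_ne fun heq => harc (mem_arcs_iff.2 ⟨ha, not_lt.1 harg, heq.symm⟩)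

lemma HasPVClosedIntegral.congr (h : HasPVClosedIntegral φ Q T v) (harc : Disjoint (arcs T) Q)
    (hφψ : EqOn ψ φ (closedPath T \ Q)) : HasPVClosedIntegral ψ Q T v := by
  rw [HasPVClosedIntegral, arcInt_congr fun w hw =>
    hφψ ⟨arcs_subset_closedPath hw, disjoint_left.1 harc hw⟩]
  exact HasPVIntegralUpTo.congr h fun τ hτ =>
    congrArg (· * deriv curveW τ) (hφψ ⟨Or.inl ⟨τ, hτ.1, rfl⟩, hτ.2⟩)

lemma HasPVClosedIntegral.const_mul (h : HasPVClosedIntegral φ Q T v) (c : ℂ) :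
    HasPVClosedIntegral (fun w => c * φ w) Q T (c * v) := by
  rw [HasPVClosedIntegral, arcInt_const_mul, ← mul_sub]
  simpa only [mul_assoc] using HasPVIntegralUpTo.const_mul h c

lemma HasPVClosedIntegral.add (hu : HasPVClosedIntegral φ Q T u) (hv : HasPVClosedIntegral ψ Q T v)
    (harc : Disjoint (arcs T) Q) (hφ : ContinuousOn φ (closedPath T \ Q))
    (hψ : ContinuousOn ψ (closedPath T \ Q)) :
    HasPVClosedIntegral (fun w => φ w + ψ w) Q T (u + v) := by
  have hsub : arcs T ⊆ closedPath T \ Q := fun w hw =>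
    ⟨arcs_subset_closedPath hw, disjoint_left.1 harc hw⟩
  have hcurve : curveW '' (Icc (-T) T \ curveW ⁻¹' Q) ⊆ closedPath T \ Q := by
    rintro _ ⟨τ, hτ, rfl⟩
    exact ⟨Or.inl ⟨τ, hτ.1, rfl⟩, hτ.2⟩
  rw [HasPVClosedIntegral, arcInt_add (hφ.mono hsub) (hψ.mono hsub), add_sub_add_comm]
  simpa only [add_mul] using HasPVIntegralUpTo.add hu hv
    (continuousOn_mul_deriv contDiff_curveW (hφ.mono hcurve))
    (continuousOn_mul_deriv contDiff_curveW (hψ.mono hcurve))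

lemma HasPVClosedIntegral.sum {ι : Type*} {s : Finset ι} {φ : ι → ℂ → ℂ} {v : ι → ℂ}
    (h : ∀ i ∈ s, HasPVClosedIntegral (φ i) Q T (v i)) (harc : Disjoint (arcs T) Q)
    (hφ : ∀ i ∈ s, ContinuousOn (φ i) (closedPath T \ Q)) :
    HasPVClosedIntegral (fun w => ∑ i ∈ s, φ i w) Q T (∑ i ∈ s, v i) := by
  classical
  induction s using Finset.induction_on with
  | empty => simp [HasPVClosedIntegral, HasPVIntegralUpTo, arcInt, lineIntegral]
  | insert i s hi ih =>
    rw [Finset.forall_mem_insert] at h hφ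
    simp only [Finset.sum_insert hi]
    exact h.1.add (ih h.2 hφ.2) harc hφ.1 (continuousOn_finsetSum _ hφ.2)

lemma hasPVClosedIntegral_of_continuousOn (hQ : (curveW ⁻¹' Q)ᶜ ∈ codiscrete ℝ) (hT : 0 < T)
    (hφ : ContinuousOn φ (closedPath T)) : HasPVClosedIntegral φ Q T (closedInt φ T) := by
  rw [HasPVClosedIntegral, closedInt, add_sub_cancel_right]
  exact hasPVIntegralUpTo_of_continuousOn hQ hT.le
    (continuousOn_mul_deriv contDiff_curveW (hφ.mono subset_union_left))

lemma hasPVClosedIntegral_inv_sub (hQ : (curveW ⁻¹' Q)ᶜ ∈ codiscrete ℝ) (hT : 0 < T)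
    (harc : Disjoint (arcs T) Q) (ha : a ∈ closedPath T → a ∈ Q) :
    HasPVClosedIntegral (fun w => (w - a)⁻¹) Q T (2 * π * I * pathWeight T a) := by
  have off_path : a ∉ closedPath T → HasPVClosedIntegral (fun w => (w - a)⁻¹) Q T
      (closedInt (fun w => (w - a)⁻¹) T) := fun h =>
    hasPVClosedIntegral_of_continuousOn hQ hT (continuousOn_inv_sub h)
  simp only [mem_closedPath_iff hT, not_and_or] at off_path
  rw [pathWeight]
  split_ifs with h0
  · rw [ofReal_one, mul_one, ← closedInt_inv_sub_of_gt hT (absurd h0)]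
    exact off_path (Or.inl (not_not.2 h0))
  rcases lt_trichotomy (Real.log ‖a‖) (pathLogRadius T (arg a)) with h | h | h
  · rw [stepTheta_of_pos (sub_pos.2 h), ofReal_one, mul_one,
      ← closedInt_inv_sub_of_gt hT fun _ => h]
    exact off_path (Or.inr h.ne)
  · have hmem := (mem_closedPath_iff hT).2 ⟨h0, h⟩
    rw [closedPath_eq_union hT] at hmem
    obtain ⟨p, hp, rfl⟩ := hmem.resolve_right fun h => disjoint_left.1 harc h
      (ha (arcs_subset_closedPath h))
    have hhalf : 2 * π * I * ((1 / 2 : ℝ) : ℂ) = π * I := by push_cast; ring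
    rw [h, sub_self, stepTheta_zero, hhalf]
    refine hasPVIntegralUpTo_of_singularity hQ (ha (Or.inl ⟨p, Ioo_subset_Icc_self hp, rfl⟩)) hp ?_
      (tendsto_closedInt_inv_sub_curveW hp)
    refine continuousOn_mul_deriv contDiff_curveW (continuousOn_inv_sub ?_)
    rintro ⟨τ, hτ, heq⟩
    exact hτ.2 (curveW_injective heq)
  · rw [stepTheta_of_neg (sub_neg.2 h), ofReal_zero, mul_zero, ← closedInt_inv_sub_of_lt hT h0 h]
    exact off_path (Or.inr h.ne')

/-- The half-residue theorem: simple poles on the curve contribute half of their residues, and the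
remainder `E'` of the partial fraction decomposition has a primitive. -/
theorem HasPartialFraction.hasPVClosedIntegral {G E c : ℂ → ℂ} {Z : Finset ℂ} {U : Set ℂ}
    (hE : HasPartialFraction G c E Z U) (hU : IsOpen U) (hpath : closedPath T ⊆ U)
    (hdiff : ∀ w ∈ closedPath T, DifferentiableAt ℂ E w)
    (hQ : (curveW ⁻¹' Q)ᶜ ∈ codiscrete ℝ) (hT : 0 < T) (harc : Disjoint (arcs T) Q)
    (hZ : ∀ a ∈ Z, a ∈ closedPath T → a ∈ Q) :
    HasPVClosedIntegral G Q T (2 * π * I * ∑ a ∈ Z, c a * pathWeight T a) := by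
  have hcont : ContinuousOn (deriv E) (closedPath T) := fun w hw => by
    refine ContinuousAt.continuousWithinAt (AnalyticAt.deriv ?_).continuousAt
    have hpunctured :=
      (eventually_mem_diff hU (hpath hw)).mono fun z hz => (hE z hz).differentiableAt
    rw [analyticAt_iff_eventually_differentiableAt]
    refine (eventually_nhdsWithin_iff.1 hpunctured).mono fun z hz => ?_
    rcases eq_or_ne z w with rfl | hne
    exacts [hdiff z hw, hz hne]
  have hregular := hasPVClosedIntegral_of_continuousOn hQ hT hcont
  rw [closedInt_of_hasDerivAt hT (fun w hw => (hdiff w hw).hasDerivAt) hcont] at hregular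
  have hpoles : ∀ a ∈ Z, HasPVClosedIntegral (fun w => c a * (w - a)⁻¹) Q T
      (c a * (2 * π * I * pathWeight T a)) := fun a ha =>
    (hasPVClosedIntegral_inv_sub hQ hT harc (hZ a ha)).const_mul (c a)
  have hpoles_cont : ∀ a ∈ Z, ContinuousOn (fun w => c a * (w - a)⁻¹) (closedPath T \ Q) :=
    fun a ha => continuousOn_const.mul (continuousOn_inv_sub fun h => h.2 (hZ a ha h.1))
  have hsum := (hregular.add (HasPVClosedIntegral.sum hpoles harc hpoles_cont) harc
    (hcont.mono sdiff_subset) (continuousOn_finsetSum _ hpoles_cont)).congr (ψ := G) harc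
    fun w hw => by
      have hderiv := (hE w ⟨hpath hw.1, fun h => hw.2 (hZ w h hw.1)⟩).deriv
      simp only [hderiv, div_eq_mul_inv, sub_add_cancel]
  convert hsum using 1
  rw [zero_add, Finset.mul_sum]
  exact Finset.sum_congr rfl fun a _ => by ring

end PVClosedIntegral

/-! ### The integrand in the plane -/

/-- The integrand after the substitution `w = e^{iθ}`: up to the factor `-i` it is the `F(θ) dθ` of
the representation, and its residue at `0` is the Appell coefficient. -/
noncomputable def planeIntegrand (g : ℂ → ℂ) (x : ℂ) (n : ℕ) (w : ℂ) : ℂ :=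
  cexp (n * w) / g (w / x) / w ^ (n + 1)

/-- The poles of `planeIntegrand` in the disc `|w| < r`. -/
def planePoles (g : ℂ → ℂ) (x : ℂ) (r : ℝ) : Set ℂ :=
  insert 0 {a | ‖a‖ < r ∧ g (a / x) = 0}

section PlaneIntegrand

variable {g : ℂ → ℂ} {x a : ℂ} {r : ℝ}

lemma integrand_eq_mul (g : ℂ → ℂ) (x : ℂ) (n : ℕ) (θ : ℂ) :
    integrand g x n θ = cexp (I * θ) * planeIntegrand g x n (cexp (I * θ)) := by
  have h := Complex.exp_ne_zero (I * θ)
  rw [integrand, planeIntegrand, mul_sub, Complex.exp_sub, Complex.exp_nat_mul (I * θ)]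
  field_simp
  ring

lemma differentiable_comp_div (hg : Differentiable ℂ g) (x : ℂ) :
    Differentiable ℂ fun w => g (w / x) :=
  hg.comp (by fun_prop)

lemma compl_zeros_mem_codiscrete (hg : Differentiable ℂ g) (hg0 : g 0 ≠ 0) (x : ℂ) :
    {w | g (w / x) = 0}ᶜ ∈ codiscrete ℂ := by
  have hdiff := differentiable_comp_div hg x
  exact AnalyticOnNhd.preimage_zero_mem_codiscrete (x := 0) (fun w _ => hdiff.analyticAt w)
    (by simpa using hg0)

lemma compl_preimage_curveW_mem_codiscrete {Q : Set ℂ} (hQ : Qᶜ ∈ codiscrete ℂ) :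
    (curveW ⁻¹' Q)ᶜ ∈ codiscrete ℝ := by
  have htendsto : ∀ τ, Tendsto curveW (𝓝[≠] τ) (𝓝[≠] (curveW τ)) := fun τ =>
    contDiff_curveW.continuous.continuousWithinAt.tendsto_nhdsWithin
      fun _ h => curveW_injective.ne h
  simp only [mem_codiscrete, disjoint_principal_right, compl_compl] at hQ ⊢
  exact fun τ => htendsto τ (hQ (curveW τ))

lemma finite_planePoles (hg : Differentiable ℂ g) (hg0 : g 0 ≠ 0) (x : ℂ) (r : ℝ) :
    (planePoles g x r).Finite := by
  have hfinite := (isCompact_closedBall (0 : ℂ) r).finite_sdiff_of_mem_codiscreteWithin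
    (codiscreteWithin_mono (subset_univ _) (compl_zeros_mem_codiscrete hg hg0 x))
  refine (hfinite.subset fun a ha => ?_).insert 0
  exact ⟨mem_closedBall_zero_iff.2 ha.1.le, not_not.2 ha.2⟩

lemma meromorphicAt_planeIntegrand (hg : Differentiable ℂ g) (x : ℂ) (n : ℕ) (a : ℂ) :
    MeromorphicAt (planeIntegrand g x n) a := by
  have hdiff := differentiable_comp_div hg x
  have hexp : AnalyticAt ℂ (fun w : ℂ => cexp (n * w)) a := by fun_prop
  have hpow : AnalyticAt ℂ (fun w : ℂ => w ^ (n + 1)) a := by fun_prop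
  exact (hexp.meromorphicAt.div (hdiff.analyticAt a).meromorphicAt).div hpow.meromorphicAt

lemma differentiableOn_planeIntegrand (hg : Differentiable ℂ g) (x : ℂ) (n : ℕ) (r : ℝ) :
    DifferentiableOn ℂ (planeIntegrand g x n) (Metric.ball 0 r \ planePoles g x r) := by
  rintro w ⟨hw, hpole⟩
  simp only [planePoles, mem_insert_iff, mem_ofPred_eq, not_or, not_and] at hpole
  have hdiff := differentiable_comp_div hg x
  have hexp : Differentiable ℂ fun w : ℂ => cexp (n * w) := by fun_prop
  exact (((hexp w).div (hdiff w) (hpole.2 (mem_ball_zero_iff.1 hw))).div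
    (differentiableAt_pow _) (pow_ne_zero _ hpole.1)).differentiableWithinAt

lemma analyticOrderAt_le_one {f : ℂ → ℂ} (hf : AnalyticAt ℂ f a)
    (hsimple : f a = 0 → deriv f a ≠ 0) : analyticOrderAt f a ≤ 1 := by
  by_cases h : f a = 0
  · exact (hf.analyticOrderAt_eq_one_of_zero_deriv_ne_zero h (hsimple h)).le
  · exact (hf.analyticOrderAt_eq_zero.2 h).trans_le zero_le_one

lemma neg_one_le_meromorphicOrderAt_planeIntegrand (hg : Differentiable ℂ g) (hx : x ≠ 0) (n : ℕ)
    (ha : a ≠ 0) (hsimple : g (a / x) = 0 → deriv g (a / x) ≠ 0) :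
    -1 ≤ meromorphicOrderAt (planeIntegrand g x n) a := by
  have hdiff := differentiable_comp_div hg x
  have horder : analyticOrderAt (fun w => g (w / x)) a ≤ 1 :=
    analyticOrderAt_le_one (hdiff.analyticAt a) fun h => by
      have hderiv := (hg (a / x)).hasDerivAt.comp a ((hasDerivAt_id a).div_const x)
      exact hderiv.deriv.trans_ne (mul_ne_zero (hsimple h) (one_div_ne_zero hx))
  have hunit : AnalyticAt ℂ (fun w : ℂ => cexp (n * w) / w ^ (n + 1)) a :=
    AnalyticAt.div (by fun_prop) (by fun_prop) (pow_ne_zero _ ha)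
  have hsplit : planeIntegrand g x n =
      (fun w => cexp (n * w) / w ^ (n + 1)) * (fun w => g (w / x))⁻¹ := by
    ext w
    rw [planeIntegrand, div_right_comm, div_eq_mul_inv]
    rfl
  rw [hsplit, meromorphicOrderAt_mul_of_ne_zero hunit
    (div_ne_zero (exp_ne_zero _) (pow_ne_zero _ ha)), meromorphicOrderAt_inv,
    (hdiff.analyticAt a).meromorphicOrderAt_eq]
  obtain ⟨k, hk⟩ := ENat.ne_top_iff_exists.1 (ne_top_of_le_ne_top ENat.one_ne_top horder)
  rw [← hk] at horder ⊢
  have hk1 : k ≤ 1 := by exact_mod_cast horder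
  have hneg : (-1 : WithTop ℤ) ≤ ((-k : ℤ) : WithTop ℤ) := WithTop.coe_le_coe.2 (by lia)
  simpa using hneg

lemma iteratedDeriv_comp_mul_left (f : ℂ → ℂ) (c : ℂ) (n : ℕ) :
    iteratedDeriv n (fun z => f (c * z)) = fun z => c ^ n * iteratedDeriv n f (c * z) := by
  induction n with
  | zero => simp
  | succ n ih =>
    ext z
    rw [iteratedDeriv_succ, ih, iteratedDeriv_succ, deriv_const_mul_field, deriv_comp_mul_left,
      smul_eq_mul]
    ring

lemma iteratedDeriv_exp_div (g : ℂ → ℂ) (hx : x ≠ 0) (n : ℕ) :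
    iteratedDeriv n (fun w => cexp (n * w) / g (w / x)) 0 = rescaledAppell g n x / x ^ n := by
  have hscale : (fun w => cexp (n * w) / g (w / x)) =
      fun w => (fun z => cexp (n * x * z) / g z) (x⁻¹ * w) := by
    ext w
    simp only [mul_assoc, mul_inv_cancel_left₀ hx, div_eq_inv_mul w]
  rw [hscale, iteratedDeriv_comp_mul_left (fun z => cexp (n * x * z) / g z)]
  simp only [mul_zero, inv_pow, inv_mul_eq_div, rescaledAppell, appell]

lemma HasResidue.eq_rescaledAppell {c : ℂ} {n : ℕ} (h : HasResidue (planeIntegrand g x n) 0 c)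
    (hg : Differentiable ℂ g) (hg0 : g 0 ≠ 0) (hx : x ≠ 0) :
    c = rescaledAppell g n x / x ^ n / n.factorial := by
  have hdiff := differentiable_comp_div hg x
  have hexp : AnalyticAt ℂ (fun w : ℂ => cexp (n * w)) 0 := by fun_prop
  rw [← iteratedDeriv_exp_div g hx n]
  refine HasResidue.eq_iteratedDeriv ?_ (hexp.div (hdiff.analyticAt 0) (by simpa using hg0))
  simp only [sub_zero]
  exact h

lemma residue_integrand_thetaZero {ζ c : ℂ} {n : ℕ} (h0 : x * ζ ≠ 0)
    (h : HasResidue (planeIntegrand g x n) (x * ζ) c) :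
    residue (integrand g x n) (thetaZero x ζ) = -I * c := by
  have hderiv : ∀ θ, deriv (fun θ => cexp (I * θ)) θ = cexp (I * θ) * I := fun θ =>
    ((hasDerivAt_const_mul I).cexp).deriv
  rw [← exp_thetaZero h0] at h
  have hθ := (HasResidue.deriv_mul_comp (e := fun θ => cexp (I * θ)) h (by fun_prop)
    (by rw [hderiv]; exact mul_ne_zero (exp_ne_zero _) I_ne_zero)).const_mul (-I)
  convert hθ.residue_eq using 2
  ext θ
  rw [integrand_eq_mul, hderiv]
  linear_combination (cexp (I * θ) * planeIntegrand g x n (cexp (I * θ))) * I_mul_I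

end PlaneIntegrand

/-! ### The contour integral of the Appell integrand -/

section Level

variable {g : ℂ → ℂ} {x : ℂ} {T r : ℝ} {Z : Finset ℂ}

lemma segmentContribution_eq (g : ℂ → ℂ) (x : ℂ) (n : ℕ) (T : ℝ) :
    segmentContribution g x n T = -I * arcInt (planeIntegrand g x n) T := by
  have hF (X : ℝ) : integrand g x n (X + (theta T).im * I) =
      arcW T X * planeIntegrand g x n (arcW T X) := integrand_eq_mul g x n _
  simp only [segmentContribution, hF, arcInt_eq_integral]
  linear_combination ((∫ X in (-π)..(theta (-T)).re, arcW T X * planeIntegrand g x n (arcW T X)) +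
    ∫ X in (theta T).re..π, arcW T X * planeIntegrand g x n (arcW T X)) * I_mul_I

lemma curve_integrand_eq (g : ℂ → ℂ) (x : ℂ) (n : ℕ) (τ : ℝ) :
    deriv theta τ * cexp (-(n : ℂ) * (τ : ℂ) ^ 2) / g (cexp (I * theta τ) / x) =
      cexp (-n) * -I * (planeIntegrand g x n (curveW τ) * deriv curveW τ) := by
  have hexp : cexp (-(n : ℂ) * (τ : ℂ) ^ 2) =
      cexp (-n) * cexp (n * (cexp (I * theta τ) - I * theta τ)) := by
    rw [← Complex.exp_add, theta_eq]
    ring_nf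
  have hderiv : deriv curveW τ = I * curveW τ * deriv theta τ :=
    deriv_exp_I_mul (contDiff_theta.of_le (by simp)) τ
  have hF := integrand_eq_mul g x n (theta τ)
  rw [integrand] at hF
  rw [hexp, hderiv, mul_div_assoc, mul_div_assoc, hF, curveW]
  linear_combination (deriv theta τ * cexp (-n) * cexp (I * theta τ) *
    planeIntegrand g x n (cexp (I * theta τ))) * I_mul_I

lemma closedPath_subset_ball (hT : 0 < T) (hr : Real.exp (-(theta T).im) < r) :
    closedPath T ⊆ Metric.ball 0 r := fun w hw => by
  obtain ⟨h0, hlog⟩ := (mem_closedPath_iff hT).1 hw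
  have hle : pathLogRadius T (arg w) ≤ -(theta T).im := by
    by_cases h : |arg w| < (theta T).re
    · exact (pathLogRadius_lt h).le
    · rw [pathLogRadius, if_neg h]
  rw [mem_ball_zero_iff]
  exact ((Real.log_le_iff_le_exp (norm_pos_iff.2 h0)).1 (hlog.trans_le hle)).trans_lt hr

lemma thetaZero_curveW_div (hx : x ≠ 0) (τ : ℝ) : thetaZero x (curveW τ / x) = theta τ := by
  rw [thetaZero, mul_div_cancel₀ _ hx, arg_curveW, log_norm_curveW]
  apply Complex.ext <;> simp

lemma disjoint_arcs_zeros (hfree : SegmentsFree g x T) :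
    Disjoint (arcs T) {w | g (w / x) = 0} :=
  disjoint_left.2 fun _ ⟨X, hX, hw⟩ hzero => hfree X hX (by rw [← hzero, ← hw]; rfl)

lemma bijOn_mul_zeros (hg0 : g 0 ≠ 0) (hx : x ≠ 0) (hr : Real.exp (-(theta T).im) < r)
    (hZ : (Z : Set ℂ) = planePoles g x r) :
    BijOn (x * ·) {ζ | g ζ = 0 ∧ (theta T).im < (thetaZero x ζ).im}
      ((Z.erase 0).filter fun a => Real.log ‖a‖ < -(theta T).im) := by
  have hmem : ∀ a, a ∈ Z ↔ a = 0 ∨ ‖a‖ < r ∧ g (a / x) = 0 := fun a => by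
    rw [← Finset.mem_coe, hZ]
    rfl
  simp only [thetaZero_im, lt_neg, Finset.coe_filter, Finset.mem_erase, hmem]
  refine ⟨fun ζ ⟨hζ, hlog⟩ => ?_, (mul_right_injective₀ hx).injOn, fun a ⟨⟨h0, ha⟩, hlog⟩ => ?_⟩
  · have h0 : x * ζ ≠ 0 := mul_ne_zero hx fun h => hg0 (h ▸ hζ)
    have hnorm := (Real.log_lt_iff_lt_exp (norm_pos_iff.2 h0)).1 hlog
    exact ⟨⟨h0, Or.inr ⟨hnorm.trans hr, by rwa [mul_div_cancel_left₀ _ hx]⟩⟩, hlog⟩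
  · have hcancel : x * (a / x) = a := mul_div_cancel₀ _ hx
    exact ⟨a / x, ⟨(ha.resolve_left h0).2, by rwa [hcancel]⟩, hcancel⟩

variable {n : ℕ} {c E : ℂ → ℂ}

lemma residueSum_eq_sum (hg0 : g 0 ≠ 0) (hx : x ≠ 0) (hT : 0 < T)
    (hr : Real.exp (-(theta T).im) < r) (hfree : SegmentsFree g x T)
    (hZ : (Z : Set ℂ) = planePoles g x r)
    (hc : ∀ a ∈ Z, HasResidue (planeIntegrand g x n) a (c a)) :
    residueSum g x n T = -I * ∑ a ∈ Z.erase 0, c a * pathWeight T a := by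
  have hbij := bijOn_mul_zeros hg0 hx hr hZ
  have hterm : ∀ ζ ∈ {ζ | g ζ = 0 ∧ (theta T).im < (thetaZero x ζ).im},
      weight (thetaZero x ζ) * residue (integrand g x n) (thetaZero x ζ) =
        -I * (c (x * ζ) * pathWeight T (x * ζ)) := fun ζ hζ => by
    obtain ⟨h0, ha⟩ := Finset.mem_erase.1 (Finset.mem_filter.1 (hbij.mapsTo hζ)).1
    rw [weight_thetaZero hT h0 hζ.2, residue_integrand_thetaZero h0 (hc _ ha)]
    ring
  have hinside : ∀ a ∈ Z.erase 0, c a * pathWeight T a ≠ 0 → Real.log ‖a‖ < -(theta T).im := by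
    intro a ha hne
    obtain ⟨h0, haZ⟩ := Finset.mem_erase.1 ha
    have hzero : g (a / x) = 0 := by
      rw [← Finset.mem_coe, hZ] at haZ
      exact (haZ.resolve_left h0).2
    contrapose! hne
    rw [pathWeight_eq_zero h0 (disjoint_right.1 (disjoint_arcs_zeros hfree) hzero) hne,
      ofReal_zero, mul_zero]
  rw [residueSum, finsum_mem_eq_of_bijOn (g := fun a => -I * (c a * pathWeight T a)) _ hbij hterm,
    finsum_mem_coe_finset, ← Finset.mul_sum, Finset.sum_filter_of_ne hinside]

lemma sum_residue_mul_pathWeight (hg : Differentiable ℂ g) (hg0 : g 0 ≠ 0) (hx : x ≠ 0)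
    (hT : 0 < T) (hr : Real.exp (-(theta T).im) < r) (hfree : SegmentsFree g x T)
    (hZ : (Z : Set ℂ) = planePoles g x r)
    (hc : ∀ a ∈ Z, HasResidue (planeIntegrand g x n) a (c a)) :
    ∑ a ∈ Z, c a * pathWeight T a =
      rescaledAppell g n x / x ^ n / n.factorial + I * residueSum g x n T := by
  have h0 : (0 : ℂ) ∈ Z := by
    rw [← Finset.mem_coe, hZ]
    exact mem_insert _ _
  rw [← Finset.add_sum_erase Z _ h0, pathWeight, if_pos rfl, ofReal_one, mul_one,
    (hc 0 h0).eq_rescaledAppell hg hg0 hx, residueSum_eq_sum hg0 hx hT hr hfree hZ hc]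
  linear_combination (∑ a ∈ Z.erase 0, c a * pathWeight T a) * I_mul_I

lemma hasPVClosedIntegral_planeIntegrand (hg : Differentiable ℂ g) (hg0 : g 0 ≠ 0) (hx : x ≠ 0)
    (n : ℕ) (hsimple : ∀ ζ, g ζ = 0 → thetaZero x ζ ∈ curveC → deriv g ζ ≠ 0) (hT : 0 < T)
    (hfree : SegmentsFree g x T) :
    HasPVClosedIntegral (planeIntegrand g x n) {w | g (w / x) = 0} T
      (2 * π * I * (rescaledAppell g n x / x ^ n / n.factorial + I * residueSum g x n T)) := by
  obtain ⟨r, hr⟩ := exists_gt (Real.exp (-(theta T).im))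
  obtain ⟨Z, hZ⟩ := (finite_planePoles hg hg0 x r).exists_finset_coe
  have hball := closedPath_subset_ball hT hr
  have harc := disjoint_arcs_zeros hfree
  have hpole : ∀ a ∈ Z, a ∈ closedPath T → g (a / x) = 0 := fun a ha hpath => by
    rw [← Finset.mem_coe, hZ] at ha
    exact (ha.resolve_left ((mem_closedPath_iff hT).1 hpath).1).2
  obtain ⟨c, E, hE, hregular⟩ := exists_hasPartialFraction (Z := Z)
    (by rw [hZ]; exact differentiableOn_planeIntegrand hg x n r)
    fun a _ => meromorphicAt_planeIntegrand hg x n a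
  have hE_diff : ∀ w ∈ closedPath T, DifferentiableAt ℂ E w := fun w hw =>
    hregular w (hball hw) fun hwZ => by
      refine neg_one_le_meromorphicOrderAt_planeIntegrand hg hx n
        ((mem_closedPath_iff hT).1 hw).1 fun hzero => hsimple _ hzero ?_
      obtain ⟨τ, -, rfl⟩ := hw.resolve_right (disjoint_right.1 harc hzero)
      rw [thetaZero_curveW_div hx]
      exact bijOn_theta.mapsTo (mem_univ τ)
  have hc : ∀ a ∈ Z, HasResidue (planeIntegrand g x n) a (c a) := fun a ha => by
    refine hE.hasResidue Metric.isOpen_ball ?_ ha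
    rw [← Finset.mem_coe, hZ] at ha
    rcases ha with rfl | ha
    · exact Metric.mem_ball_self ((Real.exp_pos _).trans hr)
    · exact mem_ball_zero_iff.2 ha.1
  rw [← sum_residue_mul_pathWeight hg hg0 hx hT hr hfree hZ hc]
  exact hE.hasPVClosedIntegral Metric.isOpen_ball hball hE_diff
    (compl_preimage_curveW_mem_codiscrete (compl_zeros_mem_codiscrete hg hg0 x)) hT harc hpole

theorem hasPVIntegralUpTo_level (hg : Differentiable ℂ g) (hg0 : g 0 ≠ 0) (hx : x ≠ 0) (n : ℕ)
    (hsimple : ∀ ζ, g ζ = 0 → thetaZero x ζ ∈ curveC → deriv g ζ ≠ 0) (hT : 0 < T)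
    (hfree : SegmentsFree g x T) :
    HasPVIntegralUpTo
      (fun τ : ℝ => deriv theta τ * cexp (-(n : ℂ) * (τ : ℂ) ^ 2) / g (cexp (I * theta τ) / x))
      {τ : ℝ | g (cexp (I * theta τ) / x) = 0} T
      (cexp (-n) * (2 * π * (rescaledAppell g n x / x ^ n / n.factorial) +
        2 * π * I * residueSum g x n T - segmentContribution g x n T)) := by
  have hpv := HasPVIntegralUpTo.const_mul
    (hasPVClosedIntegral_planeIntegrand hg hg0 hx n hsimple hT hfree) (cexp (-n) * -I)
  simp only [curve_integrand_eq]
  convert hpv using 1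
  · rfl
  · rw [segmentContribution_eq]
    linear_combination (cexp (-n) * 2 * π * (rescaledAppell g n x / x ^ n / n.factorial +
      I * residueSum g x n T)) * I_mul_I

end Level

end Appell

theorem theorem2 :
    -- `θ` is a smooth regular parametrization of the steepest-descent curve by the real line,
    -- and it solves `e^{iθ} - iθ = 1 - τ²`
    (ContDiff ℝ ∞ Appell.theta ∧ (∀ τ : ℝ, deriv Appell.theta τ ≠ 0) ∧
      BijOn Appell.theta univ Appell.curveC ∧
      (∀ τ : ℝ, cexp (I * Appell.theta τ) - I * Appell.theta τ = 1 - (τ : ℂ) ^ 2) ∧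
      (∀ τ : ℝ, 0 < τ → ∀ ϑ : ℂ,
        (ϑ ∈ Appell.regionOmega ∧ cexp (I * ϑ) - I * ϑ = 1 - (τ : ℂ) ^ 2) ↔
          ϑ = Appell.theta τ) ∧
      -- on the points used, `W` is the branch of the Lambert function with values in `regionR`
      (∀ τ : ℝ, 0 < τ → ∀ w : ℂ,
        (w ∈ Appell.regionR ∧ w * cexp w = -cexp ((τ : ℂ) ^ 2 - 1)) ↔
          w = Appell.lambertW (-cexp ((τ : ℂ) ^ 2 - 1)))) ∧
    -- the representation of the rescaled Appell polynomials
    ∀ (g : ℂ → ℂ), Differentiable ℂ g → g 0 ≠ 0 → ∀ (x : ℂ), x ≠ 0 → ∀ (n : ℕ),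
      -- the zeros on the curve are simple
      (∀ ζ : ℂ, g ζ = 0 → Appell.thetaZero x ζ ∈ Appell.curveC → deriv g ζ ≠ 0) →
      -- the contribution of the horizontal segments vanishes along an unbounded set of levels
      ∀ (S : Set ℝ), (∀ T ∈ S, 0 < T ∧ Appell.SegmentsFree g x T) →
      (∀ M : ℝ, ∃ T ∈ S, M < T) →
      Tendsto (Appell.segmentContribution g x n) (atTop ⊓ 𝓟 S) (𝓝 0) →
      -- the sum of the residues converges
      ∀ (R : ℂ), Tendsto (Appell.residueSum g x n) (atTop ⊓ 𝓟 S) (𝓝 R) →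
      ∃ J : ℂ,
        Appell.HasPVIntegral
          (fun τ : ℝ => deriv Appell.theta τ * cexp (-(n : ℂ) * (τ : ℂ) ^ 2)
            / g (cexp (I * Appell.theta τ) / x))
          {τ : ℝ | g (cexp (I * Appell.theta τ) / x) = 0} S J ∧
        Appell.rescaledAppell g n x / (n.factorial : ℂ)
          = x ^ n / (2 * Real.pi) * (cexp n * J - 2 * Real.pi * I * R) := by
  refine ⟨⟨Appell.contDiff_theta, fun τ h => ?_, Appell.bijOn_theta, Appell.theta_eq,
    fun τ hτ ϑ => Appell.mem_regionOmega_and_eq_iff hτ ϑ,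
    fun τ hτ w => Appell.mem_regionR_and_mul_exp_eq_iff hτ.ne' w⟩,
    fun g hg hg0 x hx n hsimple S hS _ hsegment R hR => ?_⟩
  · simpa [h] using Appell.deriv_theta_re_pos τ
  have hlim := (((hR.const_mul (2 * Real.pi * I)).const_add
    (2 * Real.pi * (Appell.rescaledAppell g n x / x ^ n / n.factorial))).sub
    hsegment).const_mul (cexp (-n))
  refine ⟨_, ⟨_, fun T hT =>
    Appell.hasPVIntegralUpTo_level hg hg0 hx n hsimple (hS T hT).1 (hS T hT).2, hlim⟩, ?_⟩
  have hexp : cexp n * cexp (-n) = 1 := by rw [← Complex.exp_add, add_neg_cancel, Complex.exp_zero]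
  have hpi : (Real.pi : ℂ) ≠ 0 := ofReal_ne_zero.2 Real.pi_ne_zero
  have hfactorial : (n.factorial : ℂ) ≠ 0 := Nat.cast_ne_zero.2 n.factorial_ne_zero
  rw [← mul_assoc, hexp]
  field_simp
  ring
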